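/- **Setting.** A generic unit has a ground-truth potential outcome $M^{*1}$ under treatment and $M^{*0}$ under control, a running variable $R\in\mathbb R$, a treatment indicator $D\in\{0,1\}$, an annotation indicator $A\in\{0,1\}$, covariates $X\in\mathbb R^k$ and unstructured data $U\in\mathbb R^\ell$. The design is sharp: $D=\mathbb 1\{R\ge c\}$ a.s. for a cutoff $c$. Put $M^*=DM^{*1}+(1-D)M^{*0}$ and $M=AM^*$ (the ground truth is recorded exactly when it is annotated). Let $P$ be the law of the observation $W=(M,R,D,A,X,U)$, and $\tilde X=(X,U)$. Let $\mathcal B\subset\mathbb R$ be a Borel window, $G_d=\{R\in\mathcal B,D=d\}$ and $p_d=P(G_d)>0$ for $d=0,1$. Assume: 1. (local randomization) conditionally on $R\in\mathcal B$, $D$ is independent of $(M^{*1},M^{*0})$; and $E[(M^*)^2]<\infty$; 2. (missing at random) $(U,M^*)\perp A\mid X$ and $(R,D)\perp A\mid (X,U,M^*)$; 3. (known annotation score) $P(A=1\mid X)=\pi(X)$ for a known measurable $\pi$ with values in $[\eta,1]$, for some $0<\eta<1$. The estimand is $\theta=E[M^{*1}-M^{*0}\mid R\in\mathcal B]$. Let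 $\mu_d$ be a measurable version of $\mu_d(\tilde x)=E[M\mid R\in\mathcal B,D=d,A=1,\tilde X=\tilde x]$, let $\theta_d=E[\mu_d(\tilde X)\mid R\in\mathcal B,D=d]$ and $$\varphi_d(W)=\frac{\mathbb 1_{G_d}}{p_d}\Big[\mu_d(\tilde X)+\frac{A}{\pi(X)}\big(M-\mu_d(\tilde X)\big)\Big]-\theta_d .$$ Let $W_1,W_2,\dots$ be i.i.d. with law $P$, with disjoint finite index sets $\mathcal I$ (estimation sample) and $\mathcal I'$ (training sample). Let $\hat\mu_1,\hat\mu_0$ be imputation functions that are (jointly measurable) functions of $\tilde x$ and of the training data $(W_i)_{i\in\mathcal I'}$ and that satisfy 4. (mean square consistency) $E\big[\int(\hat\mu_d(\tilde x)-\mu_d(\tilde x))^2\,dP_{\tilde X}(\tilde x)\big]\to0$ for $d=0,1$ as $|\mathcal I|,|\mathcal I'|\to\infty$. Treating $p_1,p_0$ as known, let $$\hat\theta=\hat\theta_1-\hat\theta_0,\qquad \hat\theta_d=\frac1{|\mathcal I|}\sum_{i\in\mathcal I}\frac{\mathbb 1\{R_i\in\mathcal B,D_i=d\}}{p_d}\Big[\hat\mu_d(\tilde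 X_i)+\frac{A_i}{\pi(X_i)}\big(M_i-\hat\mu_d(\tilde X_i)\big)\Big].$$ **Proposition.** As $|\mathcal I|,|\mathcal I'|\to\infty$, $$\sqrt{|\mathcal I|}\,(\hat\theta-\theta)\xrightarrow{d}N\big(0,\operatorname{Var}(\varphi(W))\big),\qquad \varphi=\varphi_1-\varphi_0 ,$$ and $\varphi$ is the efficient influence function at $P$ for $\theta$. Precisely: let $\mathcal P_\pi$ be the set of laws $Q$ of $W$ with $E_Q[M^2]<\infty$, $D=\mathbb 1\{R\ge c\}$ a.s., $M=0$ a.s. on $\{A=0\}$, and $Q(A=1\mid X,U,\mathbb 1_{G_1},\mathbb 1_{G_0})=\pi(X)$ $Q$-a.s.; and let $$\psi(Q)=p_1^{-1}E_Q[\mathbb 1_{G_1}\mu_{1,Q}(\tilde X)]-p_0^{-1}E_Q[\mathbb 1_{G_0}\mu_{0,Q}(\tilde X)],\qquad \mu_{d,Q}(\tilde X)=E_Q[M\mid R\in\mathcal B,D=d,A=1,\tilde X],$$ with $p_1,p_0$ held fixed as known constants. Then $P\in\mathcal P_\pi$ and $\psi(P)=\theta$. Moreover $\varphi\in L^2(P)$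 has mean zero and lies in the closed linear span in $L^2(P)$ of the scores at $P$ of the regular one-dimensional submodels of $\mathcal P_\pi$, and for every such submodel $(Q_t)_{t\downarrow0}$ with score $h$ one has $t^{-1}(\psi(Q_t)-\psi(P))\to E_P[\varphi h]$ as $t\downarrow0$. Here a regular submodel is a path with $Q_t\in\mathcal P_\pi$ for small $t>0$ which is differentiable in quadratic mean at $P$ with score $h\in L^2(P)$ and along which $E_{Q_t}[M^2]$ stays bounded as $t\downarrow 0$. -/

import Mathlib

open MeasureTheory ProbabilityTheory Filter Topology
open scoped ENNReal NNReal

noncomputable section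

namespace MARS

/-! ### Efficient influence functions -/

section Efficiency

variable {E : Type*} [MeasurableSpace E]

/-- The path `t ↦ Q t`, `t ↓ 0`, is differentiable in quadratic mean at `P` with score `h`:
`∫ ((√dQ_t - √dP) / t - (1/2) h √dP)² → 0`. Densities are taken with respect to the dominating
measure `P + Q t`; the integral does not depend on the dominating measure. -/
def DifferentiableInQuadraticMean (P : Measure E) (Q : ℝ → Measure E) (h : E → ℝ) : Prop :=
  Tendsto (fun t : ℝ =>
      ∫⁻ w, ENNReal.ofReal
        (((√(((Q t).rnDeriv (P + Q t) w).toReal) - √((P.rnDeriv (P + Q t) w).toReal)) / t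
          - h w * √((P.rnDeriv (P + Q t) w).toReal) / 2) ^ 2) ∂(P + Q t))
    (𝓝[>] (0 : ℝ)) (𝓝 0)

/-- `Q` is a regular one-dimensional submodel of the statistical model `model` through `P`, with
score `h`. As usual for functionals that are means of an unbounded variable `y`, the second moment
of `y` is required to remain bounded along the submodel near `P`. -/
structure IsRegularSubmodel (model : Set (Measure E)) (y : E → ℝ) (P : Measure E)
    (Q : ℝ → Measure E) (h : E → ℝ) : Prop where
  mem_model : ∀ᶠ t in 𝓝[>] (0 : ℝ), Q t ∈ model
  memLp_score : MemLp h 2 P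
  qmd : DifferentiableInQuadraticMean P Q h
  bounded_moment : ∃ C : ℝ≥0, ∀ᶠ t in 𝓝[>] (0 : ℝ), ∫⁻ w, ENNReal.ofReal (y w ^ 2) ∂(Q t) ≤ C

/-- The tangent space of `model` at `P`: the closed linear span in `L²(P)` of the scores of all
regular submodels. -/
def tangentSpace (model : Set (Measure E)) (y : E → ℝ) (P : Measure E) :
    Submodule ℝ (Lp ℝ 2 P) :=
  (Submodule.span ℝ {g : Lp ℝ 2 P | ∃ Q : ℝ → Measure E,
    IsRegularSubmodel model y P Q (fun w => g w)}).topologicalClosure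

/-- `φ` is the efficient influence function at `P` of the functional `ψ` in the model `model`:
it represents the pathwise derivative of `ψ` along every regular submodel (so that `ψ` is
pathwise differentiable), has mean zero and finite variance, and lies in the tangent space. -/
structure IsEfficientInfluenceFunction (model : Set (Measure E)) (y : E → ℝ)
    (ψ : Measure E → ℝ) (P : Measure E) (φ : E → ℝ) : Prop where
  mem_model : P ∈ model
  memLp : MemLp φ 2 P
  mean_zero : ∫ w, φ w ∂P = 0
  pathwise_derivative : ∀ (Q : ℝ → Measure E) (h : E → ℝ), IsRegularSubmodel model y P Q h →
    Tendsto (fun t : ℝ => (ψ (Q t) - ψ P) / t) (𝓝[>] (0 : ℝ)) (𝓝 (∫ w, φ w * h w ∂P))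
  mem_tangentSpace : memLp.toLp φ ∈ tangentSpace model y P

end Efficiency

/-! ### Observations -/

/-- An observation `W = (M, R, D, A, X, U)`: recorded outcome, running variable, treatment
indicator, annotation indicator, covariates in `ℝᵏ`, unstructured data in `ℝˡ`. -/
abbrev Obs (k l : ℕ) : Type := ℝ × ℝ × Bool × Bool × (Fin k → ℝ) × (Fin l → ℝ)

/-- Values of the features `X̃ = (X, U)`. -/
abbrev Feat (k l : ℕ) : Type := (Fin k → ℝ) × (Fin l → ℝ)

namespace Obs

variable {k l : ℕ}

def outcome (w : Obs k l) : ℝ := w.1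
def running (w : Obs k l) : ℝ := w.2.1
def treatment (w : Obs k l) : Bool := w.2.2.1
def annotation (w : Obs k l) : Bool := w.2.2.2.1
def covariates (w : Obs k l) : Fin k → ℝ := w.2.2.2.2.1
def feat (w : Obs k l) : Feat k l := w.2.2.2.2

end Obs

section Observed

variable {k l : ℕ}

/-- The event `{R ∈ B, D = d}`. -/
def arm (B : Set ℝ) (d : Bool) : Set (Obs k l) := {w | w.running ∈ B ∧ w.treatment = d}

/-- The event `{A = 1}`. -/
def annotated : Set (Obs k l) := {w | w.annotation = true}

/-- The random variable `𝟙{R ∈ B, D = d}`. -/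
def armIndicator (B : Set ℝ) (d : Bool) (w : Obs k l) : ℝ := (arm B d).indicator (fun _ => 1) w

/-- `f` is a version of the regression function
`μ_d(x̃) = E_P[M ∣ R ∈ B, D = d, A = 1, X̃ = x̃]`. -/
def IsRegressionFunction (P : Measure (Obs k l)) (B : Set ℝ) (d : Bool) (f : Feat k l → ℝ) :
    Prop :=
  Measurable f ∧
    (fun w => f w.feat) =ᵐ[P[|arm B d ∩ annotated]]
      (P[|arm B d ∩ annotated])[Obs.outcome | MeasurableSpace.comap Obs.feat inferInstance]

/-- The functional `Q ↦ p₁⁻¹ E_Q[𝟙{R ∈ B, D = 1} μ_{1,Q}(X̃)] - p₀⁻¹ E_Q[𝟙{R ∈ B, D = 0} μ_{0,Q}(X̃)]`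
with `μ_{d,Q}(X̃) = E_Q[M ∣ R ∈ B, D = d, A = 1, X̃]`, where the numbers `p d` are known. -/
def functional (B : Set ℝ) (p : Bool → ℝ) (Q : Measure (Obs k l)) : ℝ :=
  (p true)⁻¹ * ∫ w, armIndicator B true w *
      ((Q[|arm B true ∩ annotated])[Obs.outcome |
        MeasurableSpace.comap Obs.feat inferInstance]) w ∂Q
  - (p false)⁻¹ * ∫ w, armIndicator B false w *
      ((Q[|arm B false ∩ annotated])[Obs.outcome |
        MeasurableSpace.comap Obs.feat inferInstance]) w ∂Q

/-- `θ_d = E_P[f(X̃) ∣ R ∈ B, D = d]` (used with `f = μ_d`). -/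
def armMean (P : Measure (Obs k l)) (B : Set ℝ) (d : Bool) (f : Feat k l → ℝ) : ℝ :=
  ∫ w, f w.feat ∂(P[|arm B d])

/-- `𝟙{R ∈ B, D = d} / P(R ∈ B, D = d) * [f(X̃) + A / π(X) * (M - f(X̃))]`. -/
def aipw (P : Measure (Obs k l)) (B : Set ℝ) (π : (Fin k → ℝ) → ℝ) (d : Bool)
    (f : Feat k l → ℝ) (w : Obs k l) : ℝ :=
  armIndicator B d w / P.real (arm B d) *
    (f w.feat + (if w.annotation then 1 else 0) / π w.covariates * (w.outcome - f w.feat))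

/-- `φ_d(W)`, built from the regression function `f = μ_d`. -/
def armInfluence (P : Measure (Obs k l)) (B : Set ℝ) (π : (Fin k → ℝ) → ℝ) (d : Bool)
    (f : Feat k l → ℝ) (w : Obs k l) : ℝ :=
  aipw P B π d f w - armMean P B d f

/-- The one-step estimator `θ̂_d` computed from the observations `w i`, `i ∈ I`, with imputation
function `f`. -/
def armEstimator (P : Measure (Obs k l)) (B : Set ℝ) (π : (Fin k → ℝ) → ℝ) (d : Bool)
    (f : Feat k l → ℝ) (I : Finset ℕ) (w : ℕ → Obs k l) : ℝ :=
  (I.card : ℝ)⁻¹ * ∑ i ∈ I, aipw P B π d f (w i)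

/-- The regressors `(X, U, V)` with `V = (𝟙{R ∈ B, D = 1}, 𝟙{R ∈ B, D = 0})`. -/
def extendedFeat (B : Set ℝ) (w : Obs k l) : Feat k l × ℝ × ℝ :=
  (w.feat, armIndicator B true w, armIndicator B false w)

/-- The semiparametric model `𝒫_π` induced by a known annotation score `π`: the laws of
observations from a sharp design with cutoff `c`, with an outcome of finite second moment which is
recorded as `0` when it is not annotated, and with `P(A = 1 ∣ X, U, V) = π(X)`. -/
def annotationModel (B : Set ℝ) (c : ℝ) (π : (Fin k → ℝ) → ℝ) : Set (Measure (Obs k l)) :=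
  {Q | IsProbabilityMeasure Q ∧ MemLp Obs.outcome 2 Q ∧
    (∀ᵐ w ∂Q, w.treatment = true ↔ c ≤ w.running) ∧
    (∀ᵐ w ∂Q, w.annotation = false → w.outcome = 0) ∧
    Q⟦annotated | MeasurableSpace.comap (extendedFeat B) inferInstance⟧
      =ᵐ[Q] fun w => π w.covariates}

end Observed

/-! ### The generic unit of the population, with its potential outcomes -/

/-- The random variables of a generic unit. `potential d` is the ground truth potential outcome
`M*^d` under treatment status `d`. -/
structure PopulationUnit (k l : ℕ) (S : Type*) [MeasurableSpace S] where
  potential : Bool → S → ℝ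
  running : S → ℝ
  treatment : S → Bool
  annotation : S → Bool
  covariates : S → Fin k → ℝ
  unstructured : S → Fin l → ℝ
  measurable_potential : ∀ d, Measurable (potential d)
  measurable_running : Measurable running
  measurable_treatment : Measurable treatment
  measurable_annotation : Measurable annotation
  measurable_covariates : Measurable covariates
  measurable_unstructured : Measurable unstructured

namespace PopulationUnit

variable {k l : ℕ} {S : Type*} [MeasurableSpace S] (u : PopulationUnit k l S)

/-- The ground truth outcome `M* = D M*^1 + (1 - D) M*^0`. -/
def truth (s : S) : ℝ := if u.treatment s then u.potential true s else u.potential false s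

/-- The recorded outcome `M = A M*`. -/
def outcome (s : S) : ℝ := (if u.annotation s then 1 else 0) * u.truth s

/-- The observation `W = (M, R, D, A, X, U)`. -/
def obs (s : S) : Obs k l :=
  (u.outcome s, u.running s, u.treatment s, u.annotation s, u.covariates s, u.unstructured s)

/-- The law `P` of an observation. -/
def law (μ : Measure S) : Measure (Obs k l) := μ.map u.obs

/-- The conditioning variables `(X, U, M*)`. -/
def covUnstrTruth (s : S) : (Fin k → ℝ) × (Fin l → ℝ) × ℝ :=
  (u.covariates s, u.unstructured s, u.truth s)

lemma measurable_truth : Measurable u.truth :=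
  Measurable.ite (u.measurable_treatment (measurableSet_singleton true))
    (u.measurable_potential true) (u.measurable_potential false)

lemma measurable_covUnstrTruth : Measurable u.covUnstrTruth :=
  u.measurable_covariates.prodMk (u.measurable_unstructured.prodMk u.measurable_truth)

/-- The estimand `θ = E[M*^1 - M*^0 ∣ R ∈ B]`. -/
def estimand (μ : Measure S) (B : Set ℝ) : ℝ :=
  ∫ s, (u.potential true s - u.potential false s) ∂(μ[|u.running ⁻¹' B])

end PopulationUnit

end MARS

end

namespace MARS

section Measurability

variable {k l : ℕ}

@[fun_prop]
lemma Obs.measurable_outcome : Measurable (Obs.outcome : Obs k l → ℝ) := measurable_fst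

@[fun_prop]
lemma Obs.measurable_running : Measurable (Obs.running : Obs k l → ℝ) :=
  measurable_fst.comp measurable_snd

@[fun_prop]
lemma Obs.measurable_treatment : Measurable (Obs.treatment : Obs k l → Bool) :=
  measurable_fst.comp (measurable_snd.comp measurable_snd)

@[fun_prop]
lemma Obs.measurable_annotation : Measurable (Obs.annotation : Obs k l → Bool) :=
  measurable_fst.comp (measurable_snd.comp (measurable_snd.comp measurable_snd))

@[fun_prop]
lemma Obs.measurable_feat : Measurable (Obs.feat : Obs k l → Feat k l) :=
  measurable_snd.comp (measurable_snd.comp (measurable_snd.comp measurable_snd))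

@[fun_prop]
lemma Obs.measurable_covariates : Measurable (Obs.covariates : Obs k l → Fin k → ℝ) :=
  measurable_fst.comp Obs.measurable_feat

lemma measurableSet_arm {B : Set ℝ} (hB : MeasurableSet B) (d : Bool) :
    MeasurableSet (arm B d : Set (Obs k l)) :=
  (Obs.measurable_running hB).inter (Obs.measurable_treatment (measurableSet_singleton d))

lemma measurableSet_annotated : MeasurableSet (annotated : Set (Obs k l)) :=
  Obs.measurable_annotation (measurableSet_singleton true)

lemma measurable_armIndicator {B : Set ℝ} (hB : MeasurableSet B) (d : Bool) :
    Measurable (armIndicator B d : Obs k l → ℝ) :=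
  measurable_const.indicator (measurableSet_arm hB d)

lemma measurable_extendedFeat {B : Set ℝ} (hB : MeasurableSet B) :
    Measurable (extendedFeat B : Obs k l → Feat k l × ℝ × ℝ) :=
  Obs.measurable_feat.prodMk
    ((measurable_armIndicator hB true).prodMk (measurable_armIndicator hB false))

/-- The annotation indicator `A` as a real number. -/
noncomputable def annotationIndicator (w : Obs k l) : ℝ := if w.annotation then 1 else 0

@[fun_prop]
lemma measurable_annotationIndicator : Measurable (annotationIndicator : Obs k l → ℝ) :=
  Measurable.ite measurableSet_annotated measurable_const measurable_const

lemma annotationIndicator_eq_indicator :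
    (annotationIndicator : Obs k l → ℝ) = annotated.indicator (fun _ => 1) := by
  ext w
  simp [annotationIndicator, annotated, Set.indicator_apply]

lemma annotationIndicator_nonneg (w : Obs k l) : 0 ≤ annotationIndicator w := by
  unfold annotationIndicator; split_ifs <;> norm_num

lemma annotationIndicator_le_one (w : Obs k l) : annotationIndicator w ≤ 1 := by
  unfold annotationIndicator; split_ifs <;> norm_num

lemma armIndicator_nonneg (B : Set ℝ) (d : Bool) (w : Obs k l) : 0 ≤ armIndicator B d w :=
  Set.indicator_nonneg (fun _ _ => zero_le_one) w

lemma armIndicator_le_one (B : Set ℝ) (d : Bool) (w : Obs k l) : armIndicator B d w ≤ 1 :=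
  Set.indicator_le_self' (fun _ _ => zero_le_one) w |>.trans le_rfl

/-- The component `𝟙{R ∈ B, D = d}` of the extended features. -/
noncomputable def selectArm (d : Bool) (e : Feat k l × ℝ × ℝ) : ℝ := if d then e.2.1 else e.2.2

@[fun_prop]
lemma measurable_selectArm (d : Bool) : Measurable (selectArm (k := k) (l := l) d) := by
  cases d
  · exact measurable_snd.comp measurable_snd
  · exact measurable_fst.comp measurable_snd

@[simp]
lemma selectArm_extendedFeat (B : Set ℝ) (d : Bool) (w : Obs k l) :
    selectArm d (extendedFeat B w) = armIndicator B d w := by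
  cases d <;> rfl

@[simp]
lemma extendedFeat_fst (B : Set ℝ) (w : Obs k l) : (extendedFeat B w).1 = w.feat := rfl

lemma feat_fst (w : Obs k l) : w.feat.1 = w.covariates := rfl

end Measurability

section Model

variable {k l : ℕ} {B : Set ℝ} {c : ℝ} {π : (Fin k → ℝ) → ℝ} {η : ℝ} {Q : Measure (Obs k l)}

/-- In the annotation model, the law of the extended features of the annotated units has density
`π` with respect to the law of the extended features. -/
lemma map_restrict_annotated (hB : MeasurableSet B) (hπ0 : ∀ x, 0 ≤ π x) (hQ : Q ∈ annotationModel B c π) :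
    (Q.restrict annotated).map (extendedFeat B)
      = (Q.withDensity (fun w => ENNReal.ofReal (π w.covariates))).map (extendedFeat B) := by
  obtain ⟨_, _, _, _, hsc⟩ := hQ
  have hm := (measurable_extendedFeat (k := k) (l := l) hB).comap_le
  ext C hC
  have hC' := measurable_extendedFeat (k := k) (l := l) hB hC
  have hint : Integrable (annotated.indicator fun _ => (1 : ℝ)) Q :=
    (integrable_const 1).indicator measurableSet_annotated
  have h := setIntegral_condExp hm hint ⟨C, hC, rfl⟩
  rw [setIntegral_congr_ae₀ hC'.nullMeasurableSet (hsc.mono fun w hw _ => hw),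
    integral_indicator measurableSet_annotated] at h
  have hintπ : Integrable (fun w : Obs k l => π w.covariates) Q :=
    integrable_condExp.congr hsc
  rw [Measure.map_apply (measurable_extendedFeat hB) hC,
    Measure.map_apply (measurable_extendedFeat hB) hC, Measure.restrict_apply hC',
    withDensity_apply _ hC', ← ofReal_integral_eq_lintegral_ofReal hintπ.restrict
      (ae_of_all _ fun w => hπ0 _), h, Measure.restrict_restrict measurableSet_annotated]
  simp [Set.inter_comm]

lemma lintegral_le_of_score (hB : MeasurableSet B) (hπ : Measurable π) (hη : 0 < η)
    (hπ_ge : ∀ x, η ≤ π x) (hQ : Q ∈ annotationModel B c π) {F : Feat k l × ℝ × ℝ → ℝ≥0∞}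
    (hF : Measurable F) :
    ∫⁻ w, F (extendedFeat B w) ∂Q
      ≤ ENNReal.ofReal η⁻¹ * ∫⁻ w in annotated, F (extendedFeat B w) ∂Q := by
  have hπ0 : ∀ x, 0 ≤ π x := fun x => hη.le.trans (hπ_ge x)
  have hE := measurable_extendedFeat (k := k) (l := l) hB
  rw [← lintegral_map hF hE, ← lintegral_map hF hE, map_restrict_annotated hB hπ0 hQ,
    lintegral_map hF hE, lintegral_map hF hE,
    lintegral_withDensity_eq_lintegral_mul (g := fun w => F (extendedFeat B w)) _ (by fun_prop)
      (hF.comp hE),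
    ← lintegral_const_mul _ (by fun_prop)]
  refine lintegral_mono fun w => ?_
  simp only [Pi.mul_apply, ← mul_assoc]
  rw [← ENNReal.ofReal_mul (by positivity)]
  refine le_mul_of_one_le_left' ?_
  rw [← ENNReal.ofReal_one]
  refine ENNReal.ofReal_le_ofReal ?_
  rw [inv_mul_eq_div, one_le_div hη]
  exact hπ_ge _

/-- Inverse propensity weighting: `E_Q[(1 - A / π(X)) F(X, U, V)] = 0`. -/
lemma integral_mul_ipw_eq_zero (hB : MeasurableSet B) (hπ : Measurable π) (hη : 0 < η)
    (hπ_ge : ∀ x, η ≤ π x) (hQ : Q ∈ annotationModel B c π) {F : Feat k l × ℝ × ℝ → ℝ}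
    (hF : Measurable F) (hFi : Integrable (fun w => F (extendedFeat B w)) Q) :
    ∫ w, F (extendedFeat B w) * (1 - annotationIndicator w / π w.covariates) ∂Q = 0 := by
  have hπ0 : ∀ x, 0 ≤ π x := fun x => hη.le.trans (hπ_ge x)
  have hπ0' : ∀ x, 0 < π x := fun x => hη.trans_le (hπ_ge x)
  have hE := measurable_extendedFeat (k := k) (l := l) hB
  have key : ∫ w in annotated, F (extendedFeat B w) / π w.covariates ∂Q
      = ∫ w, F (extendedFeat B w) ∂Q := by
    let G : Feat k l × ℝ × ℝ → ℝ := fun e => F e / π e.1.1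
    have hG : Measurable G := by fun_prop
    have h1 : ∫ w in annotated, F (extendedFeat B w) / π w.covariates ∂Q
        = ∫ w in annotated, G (extendedFeat B w) ∂Q := rfl
    rw [h1, ← integral_map hE.aemeasurable hG.aestronglyMeasurable,
      map_restrict_annotated hB hπ0 hQ, integral_map hE.aemeasurable hG.aestronglyMeasurable,
      integral_withDensity_eq_integral_toReal_smul (by fun_prop) (by simp)]
    refine integral_congr_ae (ae_of_all _ fun w => ?_)
    simp only [smul_eq_mul, G, extendedFeat_fst, feat_fst, ENNReal.toReal_ofReal (hπ0 _)]
    field_simp [(hπ0' w.covariates).ne']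
  have h2 : ∀ w : Obs k l, F (extendedFeat B w) * (1 - annotationIndicator w / π w.covariates)
      = F (extendedFeat B w)
        - annotated.indicator (fun w => F (extendedFeat B w) / π w.covariates) w := by
    intro w
    rw [annotationIndicator_eq_indicator]
    by_cases h : w ∈ annotated <;> simp [h]
    ring
  have h3 : Integrable (fun w => F (extendedFeat B w) / π w.covariates) Q := by
    have : Integrable (fun w : Obs k l => (π w.covariates)⁻¹ * F (extendedFeat B w)) Q := by
      refine hFi.bdd_mul (c := η⁻¹) (Measurable.aestronglyMeasurable (by fun_prop))
        (ae_of_all _ fun w => ?_)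
      rw [norm_inv, Real.norm_of_nonneg (hπ0 _)]
      exact inv_anti₀ hη (hπ_ge _)
    simpa only [div_eq_inv_mul] using this
  simp_rw [h2]
  rw [integral_sub hFi (h3.indicator measurableSet_annotated),
    integral_indicator measurableSet_annotated, key, sub_self]

end Model

section Regression

variable {k l : ℕ} {B : Set ℝ} {c : ℝ} {π : (Fin k → ℝ) → ℝ} {η : ℝ} {Q : Measure (Obs k l)}
  {d : Bool} {f : Feat k l → ℝ}

lemma MemLp.of_cond {E : Type*} [MeasurableSpace E] {Q : Measure E} [IsFiniteMeasure Q] {s : Set E}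
    {g : E → ℝ} {p : ℝ≥0∞} (h : MemLp g p Q[|s]) : MemLp g p (Q.restrict s) := by
  by_cases hs : Q s = 0
  · simp [Measure.restrict_eq_zero.2 hs]
  have : Q.restrict s = Q s • Q[|s] := by
    rw [ProbabilityTheory.cond, smul_smul, ENNReal.mul_inv_cancel hs (measure_ne_top _ _), one_smul]
  rw [this]
  exact h.smul_measure (measure_ne_top _ _)

lemma MemLp.cond {E : Type*} [MeasurableSpace E] {Q : Measure E} {s : Set E}
    {g : E → ℝ} {p : ℝ≥0∞} (h : MemLp g p (Q.restrict s)) : MemLp g p Q[|s] := by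
  by_cases hs : Q s = 0
  · rw [ProbabilityTheory.cond, Measure.restrict_eq_zero.2 hs]
    simp
  exact h.smul_measure (ENNReal.inv_ne_top.2 hs)

lemma setIntegral_eq_of_integral_cond_eq {E : Type*} [MeasurableSpace E] {Q : Measure E}
    [IsFiniteMeasure Q] {s : Set E} {g h : E → ℝ} (hgh : ∫ w, g w ∂Q[|s] = ∫ w, h w ∂Q[|s]) :
    ∫ w in s, g w ∂Q = ∫ w in s, h w ∂Q := by
  by_cases hs : Q s = 0
  · simp [Measure.restrict_eq_zero.2 hs]
  rw [ProbabilityTheory.cond, integral_smul_measure, integral_smul_measure] at hgh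
  refine mul_left_cancel₀ ?_ hgh
  simp [ENNReal.toReal_eq_zero_iff, hs]

lemma armIndicator_mul_annotationIndicator_mul (g : Obs k l → ℝ) :
    (fun w => armIndicator B d w * annotationIndicator w * g w)
      = (arm B d ∩ annotated).indicator g := by
  ext w
  rw [annotationIndicator_eq_indicator, armIndicator]
  by_cases h : w ∈ arm B d <;> by_cases h' : w ∈ annotated <;> simp [h, h']

lemma measurableSet_arm_inter_annotated (hB : MeasurableSet B) (d : Bool) :
    MeasurableSet (arm B d ∩ annotated : Set (Obs k l)) :=
  (measurableSet_arm hB d).inter measurableSet_annotated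

/-- The `L²` norm over an arm is controlled by the `L²` norm over its annotated units. -/
lemma eLpNorm_armIndicator_mul_le (hB : MeasurableSet B) (hπ : Measurable π) (hη : 0 < η)
    (hπ_ge : ∀ x, η ≤ π x) (hQ : Q ∈ annotationModel B c π) (hf : Measurable f) :
    eLpNorm (fun w => armIndicator B d w * f w.feat) 2 Q ≤ ENNReal.ofReal η⁻¹ ^ (1 / 2 : ℝ)
      * eLpNorm (fun w => f w.feat) 2 (Q.restrict (arm B d ∩ annotated)) := by
  let F : Feat k l × ℝ × ℝ → ℝ≥0∞ := fun e => ‖selectArm d e * f e.1‖ₑ ^ (2 : ℝ)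
  have hF : Measurable F := by fun_prop
  have h := lintegral_le_of_score hB hπ hη hπ_ge hQ hF
  simp only [F, selectArm_extendedFeat, extendedFeat_fst] at h
  rw [eLpNorm_eq_lintegral_rpow_enorm_toReal two_ne_zero ENNReal.ofNat_ne_top,
    eLpNorm_eq_lintegral_rpow_enorm_toReal two_ne_zero ENNReal.ofNat_ne_top, ENNReal.toReal_ofNat,
    ← ENNReal.mul_rpow_of_nonneg _ _ (by norm_num)]
  refine ENNReal.rpow_le_rpow (h.trans_eq ?_) (by norm_num)
  rw [← lintegral_indicator (measurableSet_arm_inter_annotated hB d),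
    ← lintegral_indicator measurableSet_annotated]
  congr 1
  refine lintegral_congr fun w => ?_
  unfold armIndicator
  by_cases h : w ∈ arm B d <;> by_cases h' : w ∈ annotated <;> simp [h, h']

lemma IsRegressionFunction.memLp (hB : MeasurableSet B) (hπ : Measurable π) (hη : 0 < η)
    (hπ_ge : ∀ x, η ≤ π x) (hQ : Q ∈ annotationModel B c π) (hf : IsRegressionFunction Q B d f) :
    MemLp (fun w => armIndicator B d w * f w.feat) 2 Q := by
  have := hQ.1
  have h1 : MemLp (fun w => f w.feat) 2 (Q.restrict (arm B d ∩ annotated)) := by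
    refine MemLp.of_cond ?_
    exact (memLp_congr_ae hf.2).2 ((MemLp.cond (hQ.2.1.restrict _)).condExp one_le_two)
  have hmeas : Measurable fun w : Obs k l => armIndicator B d w * f w.feat :=
    (measurable_armIndicator hB d).mul (hf.1.comp Obs.measurable_feat)
  exact ⟨hmeas.aestronglyMeasurable, (eLpNorm_armIndicator_mul_le hB hπ hη hπ_ge hQ hf.1).trans_lt
    (ENNReal.mul_lt_top (ENNReal.rpow_lt_top_of_nonneg (by norm_num) ENNReal.ofReal_ne_top) h1.2)⟩

lemma integral_arm_mul_condExp [IsFiniteMeasure Q] (hB : MeasurableSet B) {Y : Obs k l → ℝ}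
    (hY : MemLp Y 2 Q)
    (hf : (fun w => f w.feat) =ᵐ[Q[|arm B d ∩ annotated]]
      (Q[|arm B d ∩ annotated])[Y | MeasurableSpace.comap Obs.feat inferInstance])
    {g : Feat k l → ℝ} (hg : Measurable g) {C : ℝ} (hgC : ∀ x, |g x| ≤ C) :
    ∫ w, armIndicator B d w * annotationIndicator w * (g w.feat * f w.feat) ∂Q
      = ∫ w, armIndicator B d w * annotationIndicator w * (g w.feat * Y w) ∂Q := by
  have hs := measurableSet_arm_inter_annotated (k := k) (l := l) hB d
  rw [armIndicator_mul_annotationIndicator_mul (fun w => g w.feat * f w.feat),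
    armIndicator_mul_annotationIndicator_mul (fun w => g w.feat * Y w),
    integral_indicator hs, integral_indicator hs]
  refine setIntegral_eq_of_integral_cond_eq ?_
  have hYi : Integrable Y Q[|arm B d ∩ annotated] :=
    (MemLp.cond (hY.restrict _)).integrable one_le_two
  have hgm : Measurable[MeasurableSpace.comap Obs.feat inferInstance]
      (fun w : Obs k l => g w.feat) := hg.comp (comap_measurable _)
  have h := condExp_stronglyMeasurable_mul_of_bound Obs.measurable_feat.comap_le
    hgm.stronglyMeasurable hYi C (ae_of_all _ fun w => hgC _)
  have h2 := integral_condExp (μ := Q[|arm B d ∩ annotated]) Obs.measurable_feat.comap_le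
    (f := (fun w : Obs k l => g w.feat) * Y)
  refine Eq.trans (integral_congr_ae ?_) h2
  filter_upwards [h, hf] with w hw hw2
  simp [hw, hw2]

lemma exists_isRegressionFunction (Q : Measure (Obs k l)) (B : Set ℝ) (d : Bool) :
    ∃ f : Feat k l → ℝ, IsRegressionFunction Q B d f ∧
      (Q[|arm B d ∩ annotated])[Obs.outcome | MeasurableSpace.comap Obs.feat inferInstance]
        = f ∘ Obs.feat := by
  obtain ⟨f, hf, hfe⟩ := (stronglyMeasurable_condExp (m := MeasurableSpace.comap Obs.feat
    inferInstance) (μ := Q[|arm B d ∩ annotated]) (f := Obs.outcome)).exists_eq_measurable_comp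
  exact ⟨f, ⟨hf.measurable, by rw [hfe]; rfl⟩, hfe⟩

/-- The inverse propensity weighted outcome `𝟙{R ∈ B, D = d} A M / π(X)`. -/
noncomputable def ipwOutcome (B : Set ℝ) (π : (Fin k → ℝ) → ℝ) (d : Bool) (w : Obs k l) : ℝ :=
  armIndicator B d w * annotationIndicator w * ((π w.covariates)⁻¹ * w.outcome)

lemma measurable_ipwOutcome (hB : MeasurableSet B) (hπ : Measurable π) (d : Bool) :
    Measurable (ipwOutcome B π d : Obs k l → ℝ) := by
  have := measurable_armIndicator (k := k) (l := l) hB d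
  unfold ipwOutcome
  fun_prop

lemma IsRegressionFunction.integral_eq (hB : MeasurableSet B) (hπ : Measurable π) (hη : 0 < η)
    (hπ_ge : ∀ x, η ≤ π x) (hQ : Q ∈ annotationModel B c π) (hf : IsRegressionFunction Q B d f) :
    ∫ w, armIndicator B d w * f w.feat ∂Q = ∫ w, ipwOutcome B π d w ∂Q := by
  have := hQ.1
  have hπ0' : ∀ x, 0 < π x := fun x => hη.trans_le (hπ_ge x)
  have hL : Integrable (fun w => armIndicator B d w * f w.feat) Q :=
    (hf.memLp hB hπ hη hπ_ge hQ).integrable one_le_two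
  let F : Feat k l × ℝ × ℝ → ℝ := fun e => selectArm d e * f e.1
  have hf1 := hf.1
  have hF : Measurable F := by fun_prop
  have h0 := integral_mul_ipw_eq_zero hB hπ hη hπ_ge hQ hF (by simpa [F] using hL)
  simp only [F, selectArm_extendedFeat, extendedFeat_fst] at h0
  have h1 := integral_arm_mul_condExp hB hQ.2.1 hf.2 (g := fun x => (π x.1)⁻¹) (by fun_prop) (C := η⁻¹)
    (fun x => by
      rw [abs_of_pos (inv_pos.2 (hπ0' _))]; exact inv_anti₀ hη (hπ_ge _))
  simp only [feat_fst] at h1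
  unfold ipwOutcome
  rw [← h1]
  have h2 : Integrable (fun w : Obs k l => armIndicator B d w * annotationIndicator w
      * ((π w.covariates)⁻¹ * f w.feat)) Q := by
    have : Integrable (fun w : Obs k l => (annotationIndicator w * (π w.covariates)⁻¹)
        * (armIndicator B d w * f w.feat)) Q := by
      refine hL.bdd_mul (c := 1 * η⁻¹) (Measurable.aestronglyMeasurable (by fun_prop))
        (ae_of_all _ fun w => ?_)
      rw [norm_mul, norm_inv, Real.norm_of_nonneg (hπ0' _).le,
        Real.norm_of_nonneg (annotationIndicator_nonneg _)]
      exact mul_le_mul (annotationIndicator_le_one _) (inv_anti₀ hη (hπ_ge _))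
        (inv_nonneg.2 (hπ0' _).le) zero_le_one
    refine this.congr (ae_of_all _ fun w => ?_)
    ring
  rw [← sub_eq_zero, ← integral_sub hL h2, ← h0]
  refine integral_congr_ae (ae_of_all _ fun w => ?_)
  simp only [div_eq_mul_inv]
  ring

/-- On the annotation model, the functional is linear in the law. -/
lemma functional_eq (hB : MeasurableSet B) (hπ : Measurable π) (hη : 0 < η)
    (hπ_ge : ∀ x, η ≤ π x) (p : Bool → ℝ) (hQ : Q ∈ annotationModel B c π) :
    functional B p Q = (p true)⁻¹ * ∫ w, ipwOutcome B π true w ∂Q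
      - (p false)⁻¹ * ∫ w, ipwOutcome B π false w ∂Q := by
  obtain ⟨f, hf, hfe⟩ := exists_isRegressionFunction Q B true
  obtain ⟨f', hf', hfe'⟩ := exists_isRegressionFunction Q B false
  unfold functional
  rw [hfe, hfe', ← hf.integral_eq hB hπ hη hπ_ge hQ, ← hf'.integral_eq hB hπ hη hπ_ge hQ]
  rfl

end Regression

section SqrtDensity

variable {E : Type*} [MeasurableSpace E]

lemma abs_integral_mul_le {ν : Measure E} {a b : E → ℝ} (ha : MemLp a 2 ν) (hb : MemLp b 2 ν) :
    |∫ w, a w * b w ∂ν| ≤ √(∫ w, a w ^ 2 ∂ν) * √(∫ w, b w ^ 2 ∂ν) := by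
  have h := integral_mul_norm_le_Lp_mul_Lq (μ := ν) (f := a) (g := b) Real.HolderConjugate.two_two
    (by simpa using ha) (by simpa using hb)
  have h1 : |∫ w, a w * b w ∂ν| ≤ ∫ w, ‖a w‖ * ‖b w‖ ∂ν := by
    simpa only [norm_mul, Real.norm_eq_abs] using norm_integral_le_integral_norm (μ := ν)
      (fun w => a w * b w)
  refine h1.trans (h.trans_eq ?_)
  simp [Real.sqrt_eq_rpow]

/-- The square root of the density of `P` with respect to `ν`. -/
noncomputable def sqrtDensity (P ν : Measure E) (w : E) : ℝ := √((P.rnDeriv ν w).toReal)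

@[fun_prop]
lemma measurable_sqrtDensity (P ν : Measure E) : Measurable (sqrtDensity P ν) :=
  (Measure.measurable_rnDeriv P ν).ennreal_toReal.sqrt

lemma sqrtDensity_mul_self (P ν : Measure E) (w : E) :
    sqrtDensity P ν w * sqrtDensity P ν w = (P.rnDeriv ν w).toReal :=
  Real.mul_self_sqrt ENNReal.toReal_nonneg

variable {P ν : Measure E} [IsFiniteMeasure P] [IsFiniteMeasure ν]

lemma ae_mul_sqrtDensity_congr (hP : P ≪ ν) {g h : E → ℝ} (hgh : g =ᵐ[P] h) :
    (fun w => g w * sqrtDensity P ν w) =ᵐ[ν] fun w => h w * sqrtDensity P ν w := by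
  have h1 := Measure.withDensity_rnDeriv_eq P ν hP
  rw [← h1, EventuallyEq, ae_withDensity_iff (Measure.measurable_rnDeriv P ν)] at hgh
  filter_upwards [hgh] with w hw
  by_cases h0 : P.rnDeriv ν w = 0
  · simp [sqrtDensity, h0]
  · rw [hw h0]

lemma integral_mul_sqrtDensity_mul (hP : P ≪ ν) (g h : E → ℝ) :
    ∫ w, (g w * sqrtDensity P ν w) * (h w * sqrtDensity P ν w) ∂ν = ∫ w, g w * h w ∂P := by
  rw [← integral_rnDeriv_smul hP]
  refine integral_congr_ae (ae_of_all _ fun w => ?_)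
  simp only [smul_eq_mul, ← sqrtDensity_mul_self]
  ring

lemma integral_mul_sqrtDensity_sq (hP : P ≪ ν) (g : E → ℝ) :
    ∫ w, (g w * sqrtDensity P ν w) ^ 2 ∂ν = ∫ w, g w ^ 2 ∂P := by
  simp only [pow_two]
  exact integral_mul_sqrtDensity_mul hP g g

lemma memLp_mul_sqrtDensity (hP : P ≪ ν) {g : E → ℝ} (hg : MemLp g 2 P) :
    MemLp (fun w => g w * sqrtDensity P ν w) 2 ν := by
  have hm : AEStronglyMeasurable (fun w => g w * sqrtDensity P ν w) ν := by
    refine AEStronglyMeasurable.congr ?_ (ae_mul_sqrtDensity_congr hP hg.1.ae_eq_mk).symm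
    exact hg.1.stronglyMeasurable_mk.aestronglyMeasurable.mul
      (measurable_sqrtDensity P ν).aestronglyMeasurable
  rw [memLp_two_iff_integrable_sq hm]
  refine ((integrable_rnDeriv_smul_iff hP).2 hg.integrable_sq).congr (ae_of_all _ fun w => ?_)
  simp only [smul_eq_mul, ← sqrtDensity_mul_self]
  ring

end SqrtDensity

section Pathwise

variable {E : Type*} [MeasurableSpace E]

lemma tendsto_setIntegral_abs_gt {P : Measure E} {h g : E → ℝ} (hh : MemLp h 2 P) (hg : Measurable g) :
    Tendsto (fun n : ℕ => ∫ w in {w | (n : ℝ) < |g w|}, h w ^ 2 ∂P) atTop (𝓝 0) := by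
  have := tendsto_setIntegral_of_antitone (μ := P) (f := fun w => h w ^ 2)
    (s := fun n : ℕ => {w | (n : ℝ) < |g w|})
    (fun n => measurableSet_lt measurable_const hg.abs)
    (fun n m hnm w (hw : (m : ℝ) < |g w|) => (Nat.cast_le.2 hnm).trans_lt hw) ⟨0, hh.integrable_sq.integrableOn⟩
  have hempty : ⋂ n : ℕ, {w | (n : ℝ) < |g w|} = ∅ := by
    refine Set.eq_empty_of_forall_notMem fun w hw => ?_
    obtain ⟨n, hn⟩ := exists_nat_ge |g w|
    exact not_lt.2 hn (Set.mem_iInter.1 hw n)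
  rwa [hempty, setIntegral_empty] at this

/-- The remainder of the expansion of the square root density at `P` in direction `h`. -/
noncomputable def qmdRemainder (P Q : Measure E) (h : E → ℝ) (t : ℝ) (w : E) : ℝ :=
  (sqrtDensity Q (P + Q) w - sqrtDensity P (P + Q) w) / t - h w * sqrtDensity P (P + Q) w / 2

variable {P : Measure E} [IsFiniteMeasure P]

lemma memLp_qmdRemainder {Q : Measure E} [IsFiniteMeasure Q] {h : E → ℝ} (hh : MemLp h 2 P)
    (t : ℝ) : MemLp (qmdRemainder P Q h t) 2 (P + Q) := by
  have hP : P ≪ P + Q := Measure.absolutelyContinuous_of_le (Measure.le_add_right le_rfl)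
  have hQ : Q ≪ P + Q := Measure.absolutelyContinuous_of_le (Measure.le_add_left le_rfl)
  have hs : MemLp (sqrtDensity P (P + Q)) 2 (P + Q) := by
    simpa using memLp_mul_sqrtDensity hP (memLp_const (1 : ℝ))
  have hr : MemLp (sqrtDensity Q (P + Q)) 2 (P + Q) := by
    simpa using memLp_mul_sqrtDensity hQ (memLp_const (1 : ℝ))
  have h1 := ((hr.sub hs).mul_const t⁻¹).sub ((memLp_mul_sqrtDensity hP hh).mul_const 2⁻¹)
  exact h1

lemma abs_difference_quotient_sub_le {Q : Measure E} [IsFiniteMeasure Q] {h g : E → ℝ}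
    (hh : MemLp h 2 P) (hg : Measurable g) (hgP : MemLp g 2 P) (hgQ : MemLp g 2 Q)
    {t : ℝ} (ht : 0 < t) {K G : ℝ} (hK : 0 ≤ K)
    (hG : 2 * ∫ w, g w ^ 2 ∂P + 2 * ∫ w, g w ^ 2 ∂Q ≤ G) :
    |(∫ w, g w ∂Q - ∫ w, g w ∂P) / t - ∫ w, g w * h w ∂P|
      ≤ √(∫ w, qmdRemainder P Q h t w ^ 2 ∂(P + Q)) * √G
        + √(∫ w in {w | K < |g w|}, h w ^ 2 ∂P) * √G
        + K * √(∫ w, h w ^ 2 ∂P) * (t * √(2 * ∫ w, qmdRemainder P Q h t w ^ 2 ∂(P + Q)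
          + ∫ w, h w ^ 2 ∂P)) := by
  set ν := P + Q with hν
  have hP : P ≪ ν := Measure.absolutelyContinuous_of_le (Measure.le_add_right le_rfl)
  have hQ : Q ≪ ν := Measure.absolutelyContinuous_of_le (Measure.le_add_left le_rfl)
  set s := sqrtDensity P ν with hs_def
  set r := sqrtDensity Q ν with hr_def
  set e := qmdRemainder P Q h t with he_def
  have hs : MemLp s 2 ν := by simpa using memLp_mul_sqrtDensity hP (memLp_const (1 : ℝ))
  have hr : MemLp r 2 ν := by simpa using memLp_mul_sqrtDensity hQ (memLp_const (1 : ℝ))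
  have hgs : MemLp (fun w => g w * s w) 2 ν := memLp_mul_sqrtDensity hP hgP
  have hgr : MemLp (fun w => g w * r w) 2 ν := memLp_mul_sqrtDensity hQ hgQ
  have hhs : MemLp (fun w => h w * s w) 2 ν := memLp_mul_sqrtDensity hP hh
  have he : MemLp e 2 ν := memLp_qmdRemainder hh t
  have hTm : MeasurableSet {w | K < |g w|} := measurableSet_lt measurable_const hg.abs
  set T : Set E := {w | K < |g w|} with hT
  have hTh : MemLp (fun w => T.indicator h w * s w) 2 ν :=
    memLp_mul_sqrtDensity hP (hh.indicator hTm)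
  set b : E → ℝ := fun w => Tᶜ.indicator g w with hb
  have hbm : Measurable b := hg.indicator hTm.compl
  have hbK : ∀ w, |b w| ≤ K := by
    intro w
    by_cases hw : w ∈ T
    · simp [hb, hw, hK]
    · have : w ∈ Tᶜ := hw
      simp only [hb, Set.indicator_of_mem this]
      exact not_lt.1 hw
  have hbh : MemLp (fun w => b w * (h w * s w)) 2 ν :=
    hhs.of_le_mul (c := K) (hbm.aestronglyMeasurable.mul hhs.1) (ae_of_all _ fun w => by
      rw [norm_mul]; exact mul_le_mul_of_nonneg_right (hbK w) (norm_nonneg _))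
  have hrs : MemLp (fun w => r w - s w) 2 ν := hr.sub hs
  have hsum : MemLp (fun w => g w * r w + g w * s w) 2 ν := hgr.add hgs
  have hdiff : MemLp (fun w => g w * r w - g w * s w) 2 ν := hgr.sub hgs
  -- second moments
  have iq : ∀ {f : E → ℝ}, MemLp f 2 ν → Integrable (fun w => f w ^ 2) ν := fun hf =>
    hf.integrable_sq
  have m_gs : ∫ w, (g w * s w) ^ 2 ∂ν = ∫ w, g w ^ 2 ∂P := integral_mul_sqrtDensity_sq hP g
  have m_gr : ∫ w, (g w * r w) ^ 2 ∂ν = ∫ w, g w ^ 2 ∂Q := integral_mul_sqrtDensity_sq hQ g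
  have m_hs : ∫ w, (h w * s w) ^ 2 ∂ν = ∫ w, h w ^ 2 ∂P := integral_mul_sqrtDensity_sq hP h
  have m_Th : ∫ w, (T.indicator h w * s w) ^ 2 ∂ν = ∫ w in T, h w ^ 2 ∂P := by
    rw [integral_mul_sqrtDensity_sq hP, ← integral_indicator hTm]
    refine integral_congr_ae (ae_of_all _ fun w => ?_)
    by_cases hw : w ∈ T <;> simp [hw]
  have m_add : ∀ {f₁ f₂ f : E → ℝ}, MemLp f₁ 2 ν → MemLp f₂ 2 ν → MemLp f 2 ν →
      (∀ w, f w ^ 2 ≤ 2 * f₁ w ^ 2 + 2 * f₂ w ^ 2) →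
      ∫ w, f w ^ 2 ∂ν ≤ 2 * ∫ w, f₁ w ^ 2 ∂ν + 2 * ∫ w, f₂ w ^ 2 ∂ν := by
    intro f₁ f₂ f h1 h2 h3 hle
    rw [← integral_const_mul, ← integral_const_mul,
      ← integral_add ((iq h1).const_mul _) ((iq h2).const_mul _)]
    exact integral_mono (iq h3) (((iq h1).const_mul _).add ((iq h2).const_mul _)) hle
  have b_sum : ∫ w, (g w * r w + g w * s w) ^ 2 ∂ν ≤ G := by
    have := m_add hgs hgr hsum (fun w => by nlinarith [sq_nonneg (g w * r w - g w * s w)])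
    rw [m_gs, m_gr] at this
    exact this.trans hG
  have b_diff : ∫ w, (g w * r w - g w * s w) ^ 2 ∂ν ≤ G := by
    have := m_add hgs hgr hdiff (fun w => by nlinarith [sq_nonneg (g w * r w + g w * s w)])
    rw [m_gs, m_gr] at this
    exact this.trans hG
  have hrs_eq : ∀ w, r w - s w = t * (e w + h w * s w / 2) := by
    intro w
    simp only [he_def, qmdRemainder, ← hν, ← hs_def, ← hr_def]
    field_simp
    ring
  have b_rs : √(∫ w, (r w - s w) ^ 2 ∂ν)
      ≤ t * √(2 * ∫ w, e w ^ 2 ∂ν + ∫ w, h w ^ 2 ∂P) := by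
    have h1 : ∫ w, (e w + h w * s w / 2) ^ 2 ∂ν ≤ 2 * ∫ w, e w ^ 2 ∂ν + ∫ w, h w ^ 2 ∂P := by
      have h2 : MemLp (fun w => h w * s w / 2) 2 ν := hhs.mul_const 2⁻¹
      have h3 := m_add he h2 (he.add h2)
        (fun w => by simp only [Pi.add_apply]; nlinarith [sq_nonneg (e w - h w * s w / 2)])
      simp only [Pi.add_apply] at h3
      refine h3.trans ?_
      have h4 : ∫ w, (h w * s w / 2) ^ 2 ∂ν = (∫ w, h w ^ 2 ∂P) / 4 := by
        rw [← m_hs, ← integral_div]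
        refine integral_congr_ae (ae_of_all _ fun w => ?_)
        ring
      rw [h4]
      have h5 : 0 ≤ ∫ w, h w ^ 2 ∂P := integral_nonneg fun w => sq_nonneg _
      linarith
    have h2 : ∫ w, (r w - s w) ^ 2 ∂ν = t ^ 2 * ∫ w, (e w + h w * s w / 2) ^ 2 ∂ν := by
      rw [← integral_const_mul]
      refine integral_congr_ae (ae_of_all _ fun w => ?_)
      simp only [hrs_eq]
      ring
    rw [h2, Real.sqrt_mul (sq_nonneg t), Real.sqrt_sq ht.le]
    exact mul_le_mul_of_nonneg_left (Real.sqrt_le_sqrt h1) ht.le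
  have b_bh : √(∫ w, (b w * (h w * s w)) ^ 2 ∂ν) ≤ K * √(∫ w, h w ^ 2 ∂P) := by
    rw [← m_hs, ← Real.sqrt_sq hK, ← Real.sqrt_mul (sq_nonneg K), ← integral_const_mul]
    refine Real.sqrt_le_sqrt (integral_mono (iq hbh) ((iq hhs).const_mul _) fun w => ?_)
    simp only [mul_pow (b w)]
    exact mul_le_mul_of_nonneg_right (sq_le_sq.2 ((hbK w).trans (le_abs_self K))) (sq_nonneg _)
  -- the decomposition
  have i1 : Integrable (fun w => e w * (g w * r w + g w * s w)) ν := he.integrable_mul hsum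
  have i2 : Integrable (fun w => (T.indicator h w * s w) * (g w * r w - g w * s w)) ν :=
    hTh.integrable_mul hdiff
  have i3 : Integrable (fun w => (b w * (h w * s w)) * (r w - s w)) ν := hbh.integrable_mul hrs
  have hdecomp : (∫ w, g w ∂Q - ∫ w, g w ∂P) / t - ∫ w, g w * h w ∂P
      = ∫ w, e w * (g w * r w + g w * s w) ∂ν
        + 2⁻¹ * ∫ w, (T.indicator h w * s w) * (g w * r w - g w * s w) ∂ν
        + 2⁻¹ * ∫ w, (b w * (h w * s w)) * (r w - s w) ∂ν := by
    have q1 : ∫ w, g w ∂Q = ∫ w, (g w * r w) * r w ∂ν := by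
      simpa using (integral_mul_sqrtDensity_mul hQ g (fun _ => 1)).symm
    have q2 : ∫ w, g w ∂P = ∫ w, (g w * s w) * s w ∂ν := by
      simpa using (integral_mul_sqrtDensity_mul hP g (fun _ => 1)).symm
    have q3 : ∫ w, g w * h w ∂P = ∫ w, (g w * s w) * (h w * s w) ∂ν :=
      (integral_mul_sqrtDensity_mul hP g h).symm
    have j1 : Integrable (fun w => (g w * r w) * r w) ν := hgr.integrable_mul hr
    have j2 : Integrable (fun w => (g w * s w) * s w) ν := hgs.integrable_mul hs
    have j3 : Integrable (fun w => (g w * s w) * (h w * s w)) ν := hgs.integrable_mul hhs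
    have j4 : Integrable (fun w => ((g w * r w) * r w - (g w * s w) * s w) / t) ν :=
      (j1.sub j2).div_const t
    have i12 : Integrable (fun w => e w * (g w * r w + g w * s w)
        + 2⁻¹ * ((T.indicator h w * s w) * (g w * r w - g w * s w))) ν := i1.add (i2.const_mul _)
    rw [q1, q2, q3, ← integral_sub j1 j2, ← integral_div, ← integral_sub j4 j3, ← integral_const_mul, ← integral_const_mul,
      ← integral_add i1 (i2.const_mul _), ← integral_add i12 (i3.const_mul _)]
    refine integral_congr_ae (ae_of_all _ fun w => ?_)
    simp only [he_def, qmdRemainder, ← hν, ← hs_def, ← hr_def]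
    have : h w * g w = T.indicator h w * g w + b w * h w := by
      by_cases hw : w ∈ T
      · simp [hb, hw]
      · simp [hb, hw, mul_comm]
    have ht' := ht.ne'
    linear_combination (2⁻¹ * (s w * (r w - s w))) * this
  rw [hdecomp]
  have c1 := abs_integral_mul_le he hsum
  have c2 := abs_integral_mul_le hTh hdiff
  have c3 := abs_integral_mul_le hbh hrs
  have d1 := c1.trans (mul_le_mul_of_nonneg_left (Real.sqrt_le_sqrt b_sum) (Real.sqrt_nonneg _))
  have d2 := c2.trans (mul_le_mul_of_nonneg_left (Real.sqrt_le_sqrt b_diff) (Real.sqrt_nonneg _))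
  have d3 := c3.trans (mul_le_mul b_bh b_rs (Real.sqrt_nonneg _)
    (mul_nonneg hK (Real.sqrt_nonneg _)))
  rw [m_Th] at d2
  refine (abs_add_le _ _).trans (add_le_add ((abs_add_le _ _).trans (add_le_add d1 ?_)) ?_)
  · rw [abs_mul, abs_of_pos (by norm_num : (0 : ℝ) < 2⁻¹)]
    linarith [abs_nonneg (∫ w, (T.indicator h w * s w) * (g w * r w - g w * s w) ∂ν)]
  · rw [abs_mul, abs_of_pos (by norm_num : (0 : ℝ) < 2⁻¹)]
    linarith [abs_nonneg (∫ w, (b w * (h w * s w)) * (r w - s w) ∂ν)]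

/-- Along a path which is differentiable in quadratic mean, the mean of `g` is differentiable with
derivative `E_P[g h]`, provided that the second moment of `g` stays bounded. -/
lemma DifferentiableInQuadraticMean.tendsto_integral {Q : ℝ → Measure E} {h g : E → ℝ}
    (hQ : DifferentiableInQuadraticMean P Q h) (hQf : ∀ᶠ t in 𝓝[>] (0 : ℝ), IsFiniteMeasure (Q t))
    (hh : MemLp h 2 P) (hg : Measurable g) (hgP : MemLp g 2 P) {C : ℝ≥0}
    (hgQ : ∀ᶠ t in 𝓝[>] (0 : ℝ), ∫⁻ w, ENNReal.ofReal (g w ^ 2) ∂(Q t) ≤ C) :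
    Tendsto (fun t : ℝ => (∫ w, g w ∂(Q t) - ∫ w, g w ∂P) / t) (𝓝[>] (0 : ℝ))
      (𝓝 (∫ w, g w * h w ∂P)) := by
  set δ : ℝ → ℝ := fun t => ∫ w, qmdRemainder P (Q t) h t w ^ 2 ∂(P + Q t) with hδ_def
  set H : ℝ := ∫ w, h w ^ 2 ∂P with hH
  set G : ℝ := 2 * ∫ w, g w ^ 2 ∂P + 2 * C with hG
  have hδ : Tendsto δ (𝓝[>] (0 : ℝ)) (𝓝 0) := by
    have h0 := (ENNReal.tendsto_toReal ENNReal.zero_ne_top).comp hQ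
    refine h0.congr' ?_
    filter_upwards [hQf] with t ht
    rw [Function.comp_apply, ENNReal.toReal, ← ENNReal.toReal]
    simp only [hδ_def]
    rw [integral_eq_lintegral_of_nonneg_ae (ae_of_all _ fun w => sq_nonneg _)
      (memLp_qmdRemainder hh t).integrable_sq.aestronglyMeasurable]
    rfl
  have ht0 : Tendsto (fun t : ℝ => t) (𝓝[>] (0 : ℝ)) (𝓝 0) := tendsto_nhdsWithin_of_tendsto_nhds
    tendsto_id
  have hbound : ∀ K : ℕ, ∀ᶠ t in 𝓝[>] (0 : ℝ),
      |(∫ w, g w ∂(Q t) - ∫ w, g w ∂P) / t - ∫ w, g w * h w ∂P|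
        ≤ √(δ t) * √G + √(∫ w in {w | (K : ℝ) < |g w|}, h w ^ 2 ∂P) * √G
          + K * √H * (t * √(2 * δ t + H)) := by
    intro K
    filter_upwards [hQf, hgQ, self_mem_nhdsWithin] with t h1 h2 h3
    have hgQ2 : Integrable (fun w => g w ^ 2) (Q t) :=
      ⟨(hg.pow_const 2).aestronglyMeasurable, by
        rw [hasFiniteIntegral_iff_ofReal (ae_of_all _ fun w => sq_nonneg _)]
        exact h2.trans_lt ENNReal.coe_lt_top⟩
    refine abs_difference_quotient_sub_le hh hg hgP
      ((memLp_two_iff_integrable_sq hg.aestronglyMeasurable).2 hgQ2) h3 (Nat.cast_nonneg K) ?_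
    have : ∫ w, g w ^ 2 ∂(Q t) ≤ C := by
      rw [integral_eq_lintegral_of_nonneg_ae (ae_of_all _ fun w => sq_nonneg _)
        hgQ2.aestronglyMeasurable]
      exact ENNReal.toReal_le_coe_of_le_coe h2
    linarith
  rw [tendsto_iff_dist_tendsto_zero, tendsto_order]
  refine ⟨fun a ha => Eventually.of_forall fun t => ha.trans_le dist_nonneg, fun ε hε => ?_⟩
  have hK : Tendsto (fun K : ℕ => √(∫ w in {w | (K : ℝ) < |g w|}, h w ^ 2 ∂P) * √G) atTop
      (𝓝 0) := by
    simpa using ((tendsto_setIntegral_abs_gt hh hg).sqrt).mul_const √G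
  obtain ⟨K, hK⟩ := (hK.eventually_lt_const hε).exists
  have hlim : Tendsto (fun t => √(δ t) * √G + √(∫ w in {w | (K : ℝ) < |g w|}, h w ^ 2 ∂P) * √G
      + K * √H * (t * √(2 * δ t + H))) (𝓝[>] (0 : ℝ))
      (𝓝 (√0 * √G + √(∫ w in {w | (K : ℝ) < |g w|}, h w ^ 2 ∂P) * √G
        + K * √H * (0 * √(2 * 0 + H)))) :=
    ((hδ.sqrt.mul_const _).add tendsto_const_nhds).add
      ((ht0.mul ((hδ.const_mul 2).add_const H).sqrt).const_mul _)
  filter_upwards [hbound K, hlim.eventually_lt_const (by simpa using hK)] with t h1 h2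
  rw [Real.dist_eq]
  exact h1.trans_lt h2

end Pathwise

section Paths

variable {k l : ℕ} {B : Set ℝ} {c : ℝ} {π : (Fin k → ℝ) → ℝ} {P Q : Measure (Obs k l)}

lemma abs_sqrt_one_add_sub_le {x : ℝ} (hx : -1 ≤ x) : |√(1 + x) - 1 - x / 2| ≤ x ^ 2 / 2 := by
  have h0 := Real.sqrt_nonneg (1 + x)
  have h1 := Real.sq_sqrt (by linarith : 0 ≤ 1 + x)
  set y := √(1 + x)
  have hx' : x = y ^ 2 - 1 := by linarith
  rw [abs_le, hx']
  constructor
  · nlinarith [mul_nonneg (mul_nonneg h0 (by linarith : 0 ≤ y + 2)) (sq_nonneg (y - 1))]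
  · nlinarith [sq_nonneg (y - 1), sq_nonneg (y ^ 2 - 1)]

/-- A version of `E[(A - π(X)) F(X, U, V)] = 0` for indicators `F` which characterizes the
annotation score. -/
lemma score_iff (hB : MeasurableSet B) (hπ : Measurable π) (hπ0 : ∀ x, 0 ≤ π x)
    (hπ1 : ∀ x, π x ≤ 1) [IsFiniteMeasure Q] :
    Q⟦annotated | MeasurableSpace.comap (extendedFeat B) inferInstance⟧
        =ᵐ[Q] (fun w => π w.covariates) ↔
      ∀ C, MeasurableSet C → ∫ w in extendedFeat B ⁻¹' C,
        (annotationIndicator w - π w.covariates) ∂Q = 0 := by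
  have hm := (measurable_extendedFeat (k := k) (l := l) hB).comap_le
  have ha : Integrable (annotationIndicator (k := k) (l := l)) Q := by
    rw [annotationIndicator_eq_indicator]
    exact (integrable_const 1).indicator measurableSet_annotated
  have hp : Integrable (fun w : Obs k l => π w.covariates) Q := by
    refine Integrable.of_bound (C := 1) (Measurable.aestronglyMeasurable (by fun_prop))
      (ae_of_all _ fun w => ?_)
    rw [Real.norm_of_nonneg (hπ0 _)]
    exact hπ1 _
  rw [← annotationIndicator_eq_indicator]
  constructor
  · intro h C hC
    have h1 := setIntegral_condExp hm ha ⟨C, hC, rfl⟩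
    rw [integral_sub ha.restrict hp.restrict, ← h1, sub_eq_zero]
    exact setIntegral_congr_ae₀ (measurable_extendedFeat hB hC).nullMeasurableSet
      (h.mono fun w hw _ => hw)
  · intro h
    symm
    refine ae_eq_condExp_of_forall_setIntegral_eq hm ha (fun _ _ _ => hp.integrableOn) ?_ ?_
    · rintro _ ⟨C, hC, rfl⟩ -
      have := h C hC
      rw [integral_sub ha.restrict hp.restrict, sub_eq_zero] at this
      exact this.symm
    · have h1 : Measurable[MeasurableSpace.comap (extendedFeat B) inferInstance]
          (fun w : Obs k l => π w.covariates) := by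
        have h2 : Measurable fun e : Feat k l × ℝ × ℝ => π e.1.1 := by fun_prop
        exact h2.comp (comap_measurable _)
      exact h1.stronglyMeasurable.aestronglyMeasurable

/-- The linear path through `P` in direction `h`. -/
noncomputable def linearPath (P : Measure (Obs k l)) (h : Obs k l → ℝ) (t : ℝ) :
    Measure (Obs k l) :=
  P.withDensity fun w => ENNReal.ofReal (1 + t * h w)

variable {h : Obs k l → ℝ} {C t : ℝ}

lemma abs_mul_le_half (hC : ∀ w, |h w| ≤ C) (ht : 0 < t) (htC : t * C ≤ 1 / 2) (w : Obs k l) :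
    |t * h w| ≤ 1 / 2 := by
  rw [abs_mul, abs_of_pos ht]
  exact (mul_le_mul_of_nonneg_left (hC w) ht.le).trans htC

lemma linearPath_le (hC : ∀ w, |h w| ≤ C) (ht : 0 < t) (htC : t * C ≤ 1 / 2) :
    linearPath P h t ≤ (2 : ℝ≥0∞) • P := by
  rw [← withDensity_const]
  refine withDensity_mono (ae_of_all _ fun w => ?_)
  have := abs_le.1 (abs_mul_le_half hC ht htC w)
  calc ENNReal.ofReal (1 + t * h w) ≤ ENNReal.ofReal 2 := ENNReal.ofReal_le_ofReal (by linarith)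
    _ = 2 := by simp

lemma integral_linearPath (hh : Measurable h) (hC : ∀ w, |h w| ≤ C) (ht : 0 < t)
    (htC : t * C ≤ 1 / 2) (g : Obs k l → ℝ) (s : Set (Obs k l)) (hs : MeasurableSet s) :
    ∫ w in s, g w ∂(linearPath P h t) = ∫ w in s, (1 + t * h w) * g w ∂P := by
  rw [linearPath, setIntegral_withDensity_eq_setIntegral_toReal_smul (by fun_prop) (by simp) g hs]
  refine integral_congr_ae (ae_of_all _ fun w => ?_)
  have := abs_le.1 (abs_mul_le_half hC ht htC w)
  simp only [smul_eq_mul]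
  rw [ENNReal.toReal_ofReal (by linarith)]

lemma isProbabilityMeasure_linearPath [IsProbabilityMeasure P] (hh : Measurable h)
    (hC : ∀ w, |h w| ≤ C) (ht : 0 < t) (htC : t * C ≤ 1 / 2) (h0 : ∫ w, h w ∂P = 0) :
    IsProbabilityMeasure (linearPath P h t) := by
  have hi : Integrable h P :=
    Integrable.of_bound hh.aestronglyMeasurable C (ae_of_all _ fun w => hC w)
  have hi1 : Integrable (fun w => 1 + t * h w) P := (integrable_const 1).add (hi.const_mul t)
  refine ⟨?_⟩
  rw [linearPath, withDensity_apply _ MeasurableSet.univ, Measure.restrict_univ,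
    ← ofReal_integral_eq_lintegral_ofReal hi1
    (ae_of_all _ fun w => ?_)]
  · rw [integral_add (integrable_const 1) (hi.const_mul t), integral_const_mul, h0]
    simp
  · have := abs_le.1 (abs_mul_le_half hC ht htC w)
    simp only [Pi.zero_apply]
    linarith

lemma linearPath_mem (hB : MeasurableSet B) (hπ : Measurable π) (hπ0 : ∀ x, 0 ≤ π x)
    (hπ1 : ∀ x, π x ≤ 1) (hP : P ∈ annotationModel B c π) (hh : Measurable h)
    (hC : ∀ w, |h w| ≤ C) (ht : 0 < t) (htC : t * C ≤ 1 / 2) (h0 : ∫ w, h w ∂P = 0)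
    (hscore : ∀ S, MeasurableSet S → ∫ w in extendedFeat B ⁻¹' S,
      h w * (annotationIndicator w - π w.covariates) ∂P = 0) :
    linearPath P h t ∈ annotationModel B c π := by
  obtain ⟨hP1, hP2, hP3, hP4, hP5⟩ := hP
  have hac : linearPath P h t ≪ P := withDensity_absolutelyContinuous _ _
  have hpr := isProbabilityMeasure_linearPath hh hC ht htC h0
  refine ⟨hpr, hP2.of_measure_le_smul (by simp) (linearPath_le hC ht htC), hac hP3, hac hP4, ?_⟩
  rw [score_iff hB hπ hπ0 hπ1] at hP5 ⊢
  intro S hS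
  have hS' := measurable_extendedFeat (k := k) (l := l) hB hS
  have hb : ∀ w : Obs k l, |annotationIndicator w - π w.covariates| ≤ 1 := fun w => by
    rw [abs_le]
    constructor <;> linarith [annotationIndicator_nonneg w, annotationIndicator_le_one w,
      hπ0 w.covariates, hπ1 w.covariates]
  have i1 : Integrable (fun w : Obs k l => annotationIndicator w - π w.covariates) P :=
    Integrable.of_bound (C := 1) (Measurable.aestronglyMeasurable (by fun_prop))
      (ae_of_all _ hb)
  have i2 : Integrable (fun w : Obs k l => h w * (annotationIndicator w - π w.covariates)) P :=
    i1.bdd_mul hh.aestronglyMeasurable (ae_of_all _ fun w => hC w)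
  rw [integral_linearPath hh hC ht htC _ _ hS']
  have : ∀ w : Obs k l, (1 + t * h w) * (annotationIndicator w - π w.covariates)
      = (annotationIndicator w - π w.covariates)
        + t * (h w * (annotationIndicator w - π w.covariates)) := fun w => by ring
  simp only [this]
  rw [integral_add i1.restrict (i2.const_mul t).restrict, integral_const_mul, hP5 S hS,
    hscore S hS]
  simp

lemma lintegral_qmd_linearPath_le [IsProbabilityMeasure P] (hh : Measurable h)
    (hC : ∀ w, |h w| ≤ C) (ht : 0 < t) (htC : t * C ≤ 1 / 2)
    [IsFiniteMeasure (linearPath P h t)] :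
    ∫⁻ w, ENNReal.ofReal (qmdRemainder P (linearPath P h t) h t w ^ 2) ∂(P + linearPath P h t)
      ≤ ENNReal.ofReal ((t * C ^ 2 / 2) ^ 2) := by
  set ν := P + linearPath P h t with hν
  have hPν : P ≪ ν := Measure.absolutelyContinuous_of_le (Measure.le_add_right le_rfl)
  have hνf : IsFiniteMeasure ν := by rw [hν]; infer_instance
  have hd := Measure.rnDeriv_withDensity_left_of_absolutelyContinuous
    (f := fun w => ENNReal.ofReal (1 + t * h w)) hPν (by fun_prop)
  have he : (fun w => ENNReal.ofReal (qmdRemainder P (linearPath P h t) h t w ^ 2)) =ᵐ[ν]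
      fun w => P.rnDeriv ν w *
        ENNReal.ofReal (((√(1 + t * h w) - 1 - t * h w / 2) / t) ^ 2) := by
    filter_upwards [hd, Measure.rnDeriv_lt_top P ν] with w hw hw2
    have h1 := abs_le.1 (abs_mul_le_half hC ht htC w)
    have h2 : sqrtDensity (linearPath P h t) ν w = √(1 + t * h w) * sqrtDensity P ν w := by
      unfold sqrtDensity linearPath
      rw [hw, ENNReal.toReal_mul, ENNReal.toReal_ofReal (by linarith),
        Real.sqrt_mul (by linarith)]
    have h3 : qmdRemainder P (linearPath P h t) h t w
        = sqrtDensity P ν w * ((√(1 + t * h w) - 1 - t * h w / 2) / t) := by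
      unfold qmdRemainder
      rw [← hν, h2]
      field_simp
    rw [h3, mul_pow, pow_two (sqrtDensity P ν w), sqrtDensity_mul_self,
      ENNReal.ofReal_mul ENNReal.toReal_nonneg, ENNReal.ofReal_toReal hw2.ne]
  have := Measure.haveLebesgueDecomposition_of_sigmaFinite P ν
  rw [lintegral_congr_ae he, lintegral_rnDeriv_mul hPν (by fun_prop)]
  calc ∫⁻ w, ENNReal.ofReal (((√(1 + t * h w) - 1 - t * h w / 2) / t) ^ 2) ∂P
      ≤ ∫⁻ _, ENNReal.ofReal ((t * C ^ 2 / 2) ^ 2) ∂P := by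
        refine lintegral_mono fun w => ENNReal.ofReal_le_ofReal ?_
        have h1 := abs_le.1 (abs_mul_le_half hC ht htC w)
        have h2 := abs_sqrt_one_add_sub_le (x := t * h w) (by linarith)
        have h3 : |(√(1 + t * h w) - 1 - t * h w / 2) / t| ≤ t * C ^ 2 / 2 := by
          rw [abs_div, abs_of_pos ht, div_le_iff₀ ht]
          refine h2.trans ?_
          have h4 : h w ^ 2 ≤ C ^ 2 := sq_le_sq.2 ((hC w).trans (le_abs_self C))
          nlinarith [mul_le_mul_of_nonneg_left h4 (sq_nonneg t)]
        exact sq_le_sq.2 (h3.trans (le_abs_self _))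
    _ = _ := by simp

lemma isRegularSubmodel_linearPath (hB : MeasurableSet B) (hπ : Measurable π)
    (hπ0 : ∀ x, 0 ≤ π x) (hπ1 : ∀ x, π x ≤ 1) (hP : P ∈ annotationModel B c π)
    (hh : Measurable h) (hC : ∀ w, |h w| ≤ C) (h0 : ∫ w, h w ∂P = 0)
    (hscore : ∀ S, MeasurableSet S → ∫ w in extendedFeat B ⁻¹' S,
      h w * (annotationIndicator w - π w.covariates) ∂P = 0) :
    IsRegularSubmodel (annotationModel B c π) Obs.outcome P (linearPath P h) h := by
  have hP1 := hP.1
  have hP2 := hP.2.1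
  have hsmall : ∀ᶠ t in 𝓝[>] (0 : ℝ), 0 < t ∧ t * C ≤ 1 / 2 := by
    refine (eventually_mem_nhdsWithin (a := (0 : ℝ)) (s := Set.Ioi 0)).and ?_
    have : Tendsto (fun t : ℝ => t * C) (𝓝[>] (0 : ℝ)) (𝓝 (0 * C)) :=
      (tendsto_nhdsWithin_of_tendsto_nhds tendsto_id).mul_const C
    rw [zero_mul] at this
    exact this.eventually_le_const (by norm_num)
  have hmem : ∀ᶠ t in 𝓝[>] (0 : ℝ), linearPath P h t ∈ annotationModel B c π :=
    hsmall.mono fun t ht => linearPath_mem hB hπ hπ0 hπ1 hP hh hC ht.1 ht.2 h0 hscore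
  refine ⟨hmem, MemLp.of_bound hh.aestronglyMeasurable C (ae_of_all _ fun w => hC w), ?_, ?_⟩
  · have hlim : Tendsto (fun t : ℝ => ENNReal.ofReal ((t * C ^ 2 / 2) ^ 2)) (𝓝[>] (0 : ℝ))
        (𝓝 0) := by
      have : Continuous fun t : ℝ => ENNReal.ofReal ((t * C ^ 2 / 2) ^ 2) :=
        ENNReal.continuous_ofReal.comp (by fun_prop)
      simpa using tendsto_nhdsWithin_of_tendsto_nhds (this.tendsto 0)
    refine tendsto_of_tendsto_of_tendsto_of_le_of_le' tendsto_const_nhds hlim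
      (Eventually.of_forall fun _ => zero_le) ?_
    filter_upwards [hsmall, hmem] with t ht ht2
    have := ht2.1
    exact lintegral_qmd_linearPath_le hh hC ht.1 ht.2
  · have hfin : 2 * ∫⁻ w, ENNReal.ofReal (w.outcome ^ 2) ∂P ≠ ∞ := by
      refine ENNReal.mul_ne_top (by simp) ?_
      have := hP2.integrable_sq.2
      rw [hasFiniteIntegral_iff_ofReal (ae_of_all _ fun w => sq_nonneg _)] at this
      exact this.ne
    refine ⟨(2 * ∫⁻ w, ENNReal.ofReal (w.outcome ^ 2) ∂P).toNNReal, hsmall.mono fun t ht => ?_⟩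
    rw [ENNReal.coe_toNNReal hfin]
    refine (lintegral_mono' (linearPath_le hC ht.1 ht.2) le_rfl).trans ?_
    rw [lintegral_smul_measure, smul_eq_mul]

lemma IsRegularSubmodel.congr {Qt : ℝ → Measure (Obs k l)} {h' : Obs k l → ℝ}
    (hP : P ∈ annotationModel B c π)
    (hQ : IsRegularSubmodel (annotationModel B c π) Obs.outcome P Qt h) (hhh : h =ᵐ[P] h') :
    IsRegularSubmodel (annotationModel B c π) Obs.outcome P Qt h' := by
  have := hP.1
  refine ⟨hQ.mem_model, (memLp_congr_ae hhh).1 hQ.memLp_score, ?_, hQ.bounded_moment⟩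
  refine hQ.qmd.congr' ?_
  filter_upwards [hQ.mem_model] with t ht
  have := ht.1
  have hPν : P ≪ P + Qt t := Measure.absolutelyContinuous_of_le (Measure.le_add_right le_rfl)
  refine lintegral_congr_ae ?_
  filter_upwards [ae_mul_sqrtDensity_congr hPν hhh] with w hw
  simp only [sqrtDensity] at hw
  rw [hw]

/-- Bounded mean-zero functions which satisfy the restriction imposed by the annotation score
belong to the tangent space. -/
lemma toLp_mem_tangentSpace (hB : MeasurableSet B) (hπ : Measurable π)
    (hπ0 : ∀ x, 0 ≤ π x) (hπ1 : ∀ x, π x ≤ 1) (hP : P ∈ annotationModel B c π)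
    (hh : Measurable h) (hC : ∀ w, |h w| ≤ C) (h0 : ∫ w, h w ∂P = 0)
    (hscore : ∀ S, MeasurableSet S → ∫ w in extendedFeat B ⁻¹' S,
      h w * (annotationIndicator w - π w.covariates) ∂P = 0) (hL : MemLp h 2 P) :
    hL.toLp h ∈ tangentSpace (annotationModel B c π) Obs.outcome P := by
  refine Submodule.le_topologicalClosure _ (Submodule.subset_span ⟨linearPath P h, ?_⟩)
  exact (isRegularSubmodel_linearPath hB hπ hπ0 hπ1 hP hh hC h0 hscore).congr hP
    hL.coeFn_toLp.symm

end Paths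

section Influence

variable {k l : ℕ} {B : Set ℝ} {c : ℝ} {π : (Fin k → ℝ) → ℝ} {η : ℝ} {P : Measure (Obs k l)}
  {d : Bool} {f : Feat k l → ℝ} {reg : Bool → Feat k l → ℝ}

lemma aipw_eq (P : Measure (Obs k l)) (B : Set ℝ) (π : (Fin k → ℝ) → ℝ) (d : Bool)
    (f : Feat k l → ℝ) (w : Obs k l) :
    aipw P B π d f w = (P.real (arm B d))⁻¹ *
      (armIndicator B d w * f w.feat * (1 - annotationIndicator w / π w.covariates)
        + ipwOutcome B π d w) := by
  unfold aipw ipwOutcome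
  change _ * (_ + annotationIndicator w / _ * _) = _
  ring

lemma abs_annotationIndicator_div_le (hη : 0 < η) (hπ_ge : ∀ x, η ≤ π x) (w : Obs k l) :
    |annotationIndicator w / π w.covariates| ≤ η⁻¹ := by
  have h0 := hη.trans_le (hπ_ge w.covariates)
  rw [abs_div, abs_of_nonneg (annotationIndicator_nonneg w), abs_of_pos h0, ← one_div]
  exact div_le_div₀ zero_le_one (annotationIndicator_le_one w) hη (hπ_ge _)

lemma abs_one_sub_annotationIndicator_div_le (hη : 0 < η) (hπ_ge : ∀ x, η ≤ π x) (w : Obs k l) :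
    |1 - annotationIndicator w / π w.covariates| ≤ 1 + η⁻¹ :=
  (abs_sub _ _).trans (by simpa using abs_annotationIndicator_div_le hη hπ_ge w)

lemma measurable_one_sub_annotationIndicator_div (hπ : Measurable π) :
    Measurable fun w : Obs k l => 1 - annotationIndicator w / π w.covariates := by fun_prop

lemma abs_ipwOutcome_le (hη : 0 < η) (hπ_ge : ∀ x, η ≤ π x) (B : Set ℝ) (d : Bool)
    (w : Obs k l) : |ipwOutcome B π d w| ≤ η⁻¹ * |w.outcome| := by
  have : ipwOutcome B π d w
      = armIndicator B d w * (annotationIndicator w / π w.covariates) * w.outcome := by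
    unfold ipwOutcome; ring
  rw [this, abs_mul, abs_mul, abs_of_nonneg (armIndicator_nonneg B d w)]
  refine mul_le_mul_of_nonneg_right ?_ (abs_nonneg _)
  calc armIndicator B d w * |annotationIndicator w / π w.covariates| ≤ 1 * η⁻¹ :=
        mul_le_mul (armIndicator_le_one B d w) (abs_annotationIndicator_div_le hη hπ_ge w)
          (abs_nonneg _) zero_le_one
    _ = η⁻¹ := one_mul _

lemma memLp_ipwOutcome (hB : MeasurableSet B) (hπ : Measurable π) (hη : 0 < η)
    (hπ_ge : ∀ x, η ≤ π x) (hP : P ∈ annotationModel B c π) (d : Bool) :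
    MemLp (ipwOutcome B π d) 2 P :=
  hP.2.1.of_le_mul (c := η⁻¹) (measurable_ipwOutcome hB hπ d).aestronglyMeasurable
    (ae_of_all _ fun w => abs_ipwOutcome_le hη hπ_ge B d w)

lemma memLp_mul_one_sub (hπ : Measurable π) (hη : 0 < η) (hπ_ge : ∀ x, η ≤ π x) {p : ℝ≥0∞}
    {g : Obs k l → ℝ} (hg : MemLp g p P) :
    MemLp (fun w => g w * (1 - annotationIndicator w / π w.covariates)) p P :=
  hg.of_le_mul (c := 1 + η⁻¹)
    (hg.1.mul (measurable_one_sub_annotationIndicator_div hπ).aestronglyMeasurable)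
    (ae_of_all _ fun w => by
      rw [norm_mul, mul_comm]
      exact mul_le_mul_of_nonneg_right (abs_one_sub_annotationIndicator_div_le hη hπ_ge w)
        (norm_nonneg _))

lemma integral_arm_mul_one_sub (hB : MeasurableSet B) (hπ : Measurable π) (hη : 0 < η)
    (hπ_ge : ∀ x, η ≤ π x) (hP : P ∈ annotationModel B c π) (hf : Measurable f)
    (hfi : Integrable (fun w => armIndicator B d w * f w.feat) P) :
    ∫ w, armIndicator B d w * f w.feat * (1 - annotationIndicator w / π w.covariates) ∂P = 0 := by
  let F : Feat k l × ℝ × ℝ → ℝ := fun e => selectArm d e * f e.1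
  have hF : Measurable F := by fun_prop
  simpa [F] using integral_mul_ipw_eq_zero hB hπ hη hπ_ge hP hF (by simpa [F] using hfi)

lemma memLp_aipw (hB : MeasurableSet B) (hπ : Measurable π) (hη : 0 < η)
    (hπ_ge : ∀ x, η ≤ π x) (hP : P ∈ annotationModel B c π) (hf : IsRegressionFunction P B d f) :
    MemLp (aipw P B π d f) 2 P := by
  have h := ((memLp_mul_one_sub hπ hη hπ_ge (hf.memLp hB hπ hη hπ_ge hP)).add
    (memLp_ipwOutcome hB hπ hη hπ_ge hP d)).const_mul (P.real (arm B d))⁻¹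
  exact h.ae_eq (ae_of_all _ fun w => (aipw_eq P B π d f w).symm)

lemma integral_aipw (hB : MeasurableSet B) (hπ : Measurable π) (hη : 0 < η)
    (hπ_ge : ∀ x, η ≤ π x) (hP : P ∈ annotationModel B c π) (hf : IsRegressionFunction P B d f) :
    ∫ w, aipw P B π d f w ∂P = (P.real (arm B d))⁻¹ * ∫ w, ipwOutcome B π d w ∂P := by
  have := hP.1
  have h1 := hf.memLp hB hπ hη hπ_ge hP
  simp only [aipw_eq]
  rw [integral_const_mul, integral_add ((memLp_mul_one_sub hπ hη hπ_ge h1).integrable one_le_two)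
    ((memLp_ipwOutcome hB hπ hη hπ_ge hP d).integrable one_le_two),
    integral_arm_mul_one_sub hB hπ hη hπ_ge hP hf.1 (h1.integrable one_le_two), zero_add]

lemma armMean_eq (hB : MeasurableSet B) (hπ : Measurable π) (hη : 0 < η)
    (hπ_ge : ∀ x, η ≤ π x) (hP : P ∈ annotationModel B c π) (hf : IsRegressionFunction P B d f) :
    armMean P B d f = (P.real (arm B d))⁻¹ * ∫ w, ipwOutcome B π d w ∂P := by
  rw [← hf.integral_eq hB hπ hη hπ_ge hP, armMean, ProbabilityTheory.cond, integral_smul_measure,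
    ENNReal.toReal_inv, smul_eq_mul, ← integral_indicator (measurableSet_arm hB d)]
  congr 1
  refine integral_congr_ae (ae_of_all _ fun w => ?_)
  unfold armIndicator
  by_cases h : w ∈ arm B d <;> simp [h]

lemma memLp_armInfluence (hB : MeasurableSet B) (hπ : Measurable π) (hη : 0 < η)
    (hπ_ge : ∀ x, η ≤ π x) (hP : P ∈ annotationModel B c π) (hf : IsRegressionFunction P B d f) :
    MemLp (armInfluence P B π d f) 2 P := by
  have := hP.1
  exact (memLp_aipw hB hπ hη hπ_ge hP hf).sub (memLp_const _)

lemma integral_armInfluence (hB : MeasurableSet B) (hπ : Measurable π) (hη : 0 < η)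
    (hπ_ge : ∀ x, η ≤ π x) (hP : P ∈ annotationModel B c π) (hf : IsRegressionFunction P B d f) :
    ∫ w, armInfluence P B π d f w ∂P = 0 := by
  have := hP.1
  unfold armInfluence
  rw [integral_sub ((memLp_aipw hB hπ hη hπ_ge hP hf).integrable one_le_two) (integrable_const _),
    integral_aipw hB hπ hη hπ_ge hP hf, armMean_eq hB hπ hη hπ_ge hP hf]
  simp

lemma functional_eq_armMean_sub (hB : MeasurableSet B) (hπ : Measurable π) (hη : 0 < η)
    (hπ_ge : ∀ x, η ≤ π x) (hP : P ∈ annotationModel B c π)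
    (hreg : ∀ d, IsRegressionFunction P B d (reg d)) :
    functional B (fun d => P.real (arm B d)) P
      = armMean P B true (reg true) - armMean P B false (reg false) := by
  rw [functional_eq hB hπ hη hπ_ge _ hP, armMean_eq hB hπ hη hπ_ge hP (hreg true),
    armMean_eq hB hπ hη hπ_ge hP (hreg false)]

/-! ### The pathwise derivative -/

variable {Q : ℝ → Measure (Obs k l)} {h : Obs k l → ℝ}

lemma IsRegularSubmodel.eventually_isFiniteMeasure
    (hQ : IsRegularSubmodel (annotationModel B c π) Obs.outcome P Q h) :
    ∀ᶠ t in 𝓝[>] (0 : ℝ), IsFiniteMeasure (Q t) :=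
  hQ.mem_model.mono fun _ ht => have := ht.1; inferInstance

/-- A bounded function whose mean is constant along a regular submodel is orthogonal to the
score. -/
lemma IsRegularSubmodel.integral_mul_score_eq_zero (hP : P ∈ annotationModel B c π)
    (hQ : IsRegularSubmodel (annotationModel B c π) Obs.outcome P Q h)
    {g : Obs k l → ℝ} (hg : Measurable g) {C : ℝ} (hC : ∀ w, |g w| ≤ C) {a : ℝ}
    (ha : ∀ P' ∈ annotationModel B c π, ∫ w, g w ∂P' = a) : ∫ w, g w * h w ∂P = 0 := by
  have := hP.1
  have hlim := hQ.qmd.tendsto_integral hQ.eventually_isFiniteMeasure hQ.memLp_score hg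
    (MemLp.of_bound hg.aestronglyMeasurable C (ae_of_all _ hC)) (C := Real.toNNReal (C ^ 2)) ?_
  · refine tendsto_nhds_unique hlim (tendsto_const_nhds.congr' ?_)
    filter_upwards [hQ.mem_model] with t ht
    rw [ha _ ht, ha _ hP, sub_self, zero_div]
  · filter_upwards [hQ.mem_model] with t ht
    have := ht.1
    calc ∫⁻ w, ENNReal.ofReal (g w ^ 2) ∂(Q t) ≤ ∫⁻ _, ENNReal.ofReal (C ^ 2) ∂(Q t) :=
          lintegral_mono fun w => ENNReal.ofReal_le_ofReal
            (sq_le_sq.2 ((hC w).trans (le_abs_self C)))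
      _ = _ := by simp [ENNReal.ofReal]

lemma IsRegularSubmodel.integral_score (hP : P ∈ annotationModel B c π)
    (hQ : IsRegularSubmodel (annotationModel B c π) Obs.outcome P Q h) : ∫ w, h w ∂P = 0 := by
  have := hQ.integral_mul_score_eq_zero hP (g := fun _ => 1) measurable_const (C := 1) (by simp)
    (a := 1) (fun R hR => by have := hR.1; simp)
  simpa using this

lemma IsRegularSubmodel.integral_arm_mul_score (hB : MeasurableSet B) (hπ : Measurable π)
    (hη : 0 < η) (hπ_ge : ∀ x, η ≤ π x) (hP : P ∈ annotationModel B c π)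
    (hQ : IsRegularSubmodel (annotationModel B c π) Obs.outcome P Q h)
    (hf : Measurable f) (hfL : MemLp (fun w => armIndicator B d w * f w.feat) 2 P) :
    ∫ w, armIndicator B d w * f w.feat * (1 - annotationIndicator w / π w.covariates) * h w ∂P
      = 0 := by
  have hA := measurable_armIndicator (k := k) (l := l) hB d
  set f' : ℕ → Feat k l → ℝ := fun n => {x | |f x| ≤ n}.indicator f with hf'
  have hf'm : ∀ n, Measurable (f' n) := fun n =>
    hf.indicator (measurableSet_le hf.abs measurable_const)
  have hf'b : ∀ n x, |f' n x| ≤ n := by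
    intro n x
    by_cases hx : x ∈ {x | |f x| ≤ n}
    · simpa [hf', Set.indicator_of_mem hx] using hx
    · simp [hf', Set.indicator_of_notMem hx]
  have hAb : ∀ n (w : Obs k l), |armIndicator B d w * f' n w.feat| ≤ n := fun n w => by
    rw [abs_mul, abs_of_nonneg (armIndicator_nonneg B d w)]
    calc armIndicator B d w * |f' n w.feat| ≤ 1 * n :=
          mul_le_mul (armIndicator_le_one B d w) (hf'b n _) (abs_nonneg _) zero_le_one
      _ = n := one_mul _
  have hAm : ∀ n, Measurable fun w : Obs k l => armIndicator B d w * f' n w.feat := fun n =>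
    hA.mul ((hf'm n).comp Obs.measurable_feat)
  have hzero : ∀ n, ∫ w, armIndicator B d w * f' n w.feat
      * (1 - annotationIndicator w / π w.covariates) * h w ∂P = 0 := by
    intro n
    refine hQ.integral_mul_score_eq_zero hP
      ((hAm n).mul (measurable_one_sub_annotationIndicator_div hπ)) (C := n * (1 + η⁻¹))
      (fun w => ?_) (a := 0) (fun R hR => ?_)
    · rw [abs_mul]
      exact mul_le_mul (hAb n w) (abs_one_sub_annotationIndicator_div_le hη hπ_ge w)
        (abs_nonneg _) (Nat.cast_nonneg n)
    · have := hR.1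
      exact integral_arm_mul_one_sub hB hπ hη hπ_ge hR (hf'm n)
        (Integrable.of_bound (hAm n).aestronglyMeasurable n (ae_of_all _ (hAb n)))
  have hL := memLp_mul_one_sub hπ hη hπ_ge hfL
  have hi : Integrable (fun w => armIndicator B d w * f w.feat
      * (1 - annotationIndicator w / π w.covariates) * h w) P := hL.integrable_mul hQ.memLp_score
  have hlim := tendsto_integral_of_dominated_convergence (μ := P)
    (F := fun n w => armIndicator B d w * f' n w.feat
      * (1 - annotationIndicator w / π w.covariates) * h w)
    (f := fun w => armIndicator B d w * f w.feat
      * (1 - annotationIndicator w / π w.covariates) * h w) _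
    (fun n => (((hAm n).mul (measurable_one_sub_annotationIndicator_div hπ)).aestronglyMeasurable).mul
      hQ.memLp_score.1) hi.norm
    (fun n => ae_of_all _ fun w => ?_) (ae_of_all _ fun w => ?_)
  · simp only [hzero] at hlim
    exact tendsto_nhds_unique hlim tendsto_const_nhds
  · simp only [norm_mul]
    gcongr
    simp only [hf']
    exact norm_indicator_le_norm_self f w.feat
  · refine ((tendsto_const_nhds.mul ?_).mul_const _).mul_const _
    refine tendsto_const_nhds.congr' ?_
    obtain ⟨n, hn⟩ := exists_nat_ge |f w.feat|
    filter_upwards [eventually_ge_atTop n] with m hm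
    have : w.feat ∈ {x | |f x| ≤ m} := hn.trans (Nat.cast_le.2 hm)
    simp only [hf', Set.indicator_of_mem this]

/-- The influence function represents the derivative of the functional along every regular
submodel. -/
lemma tendsto_functional_difference_quotient (hB : MeasurableSet B) (hπ : Measurable π)
    (hη : 0 < η) (hπ_ge : ∀ x, η ≤ π x) (hP : P ∈ annotationModel B c π)
    (hreg : ∀ d, IsRegressionFunction P B d (reg d))
    (hQ : IsRegularSubmodel (annotationModel B c π) Obs.outcome P Q h) :
    Tendsto (fun t : ℝ => (functional B (fun d => P.real (arm B d)) (Q t)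
        - functional B (fun d => P.real (arm B d)) P) / t) (𝓝[>] (0 : ℝ))
      (𝓝 (∫ w, (armInfluence P B π true (reg true) w
        - armInfluence P B π false (reg false) w) * h w ∂P)) := by
  have hP1 := hP.1
  set p : Bool → ℝ := fun d => P.real (arm B d) with hp
  obtain ⟨C, hC⟩ := hQ.bounded_moment
  have hd : ∀ d, Tendsto (fun t : ℝ => (∫ w, ipwOutcome B π d w ∂(Q t)
      - ∫ w, ipwOutcome B π d w ∂P) / t) (𝓝[>] (0 : ℝ)) (𝓝 (∫ w, ipwOutcome B π d w * h w ∂P)) := by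
    intro d
    refine hQ.qmd.tendsto_integral hQ.eventually_isFiniteMeasure hQ.memLp_score
      (measurable_ipwOutcome hB hπ d) (memLp_ipwOutcome hB hπ hη hπ_ge hP d)
      (C := Real.toNNReal (η⁻¹ ^ 2) * C) ?_
    filter_upwards [hC] with t ht
    rw [ENNReal.coe_mul]
    refine le_trans ?_ (mul_le_mul_right ht _)
    rw [← lintegral_const_mul _ (by fun_prop)]
    refine lintegral_mono fun w => ?_
    change _ ≤ ENNReal.ofReal _ * _
    rw [← ENNReal.ofReal_mul (sq_nonneg _), ← mul_pow]
    refine ENNReal.ofReal_le_ofReal (sq_le_sq.2 ?_)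
    rw [abs_mul, abs_of_pos (inv_pos.2 hη)]
    exact abs_ipwOutcome_le hη hπ_ge B d w
  have hscore : ∀ d, ∫ w, armInfluence P B π d (reg d) w * h w ∂P
      = (p d)⁻¹ * ∫ w, ipwOutcome B π d w * h w ∂P := by
    intro d
    have hL := (hreg d).memLp hB hπ hη hπ_ge hP
    have h1 := hQ.integral_arm_mul_score hB hπ hη hπ_ge hP (hreg d).1 hL
    have h2 := hQ.integral_score hP
    have i1 : Integrable (fun w => armIndicator B d w * reg d w.feat
        * (1 - annotationIndicator w / π w.covariates) * h w) P :=
      (memLp_mul_one_sub hπ hη hπ_ge hL).integrable_mul hQ.memLp_score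
    have i2 : Integrable (fun w => ipwOutcome B π d w * h w) P :=
      (memLp_ipwOutcome hB hπ hη hπ_ge hP d).integrable_mul hQ.memLp_score
    have i3 : Integrable h P := hQ.memLp_score.integrable one_le_two
    have i4 : Integrable (fun w => armIndicator B d w * reg d w.feat
        * (1 - annotationIndicator w / π w.covariates) * h w + ipwOutcome B π d w * h w) P :=
      i1.add i2
    have he : ∀ w, armInfluence P B π d (reg d) w * h w
        = (p d)⁻¹ * (armIndicator B d w * reg d w.feat
          * (1 - annotationIndicator w / π w.covariates) * h w + ipwOutcome B π d w * h w)
          - armMean P B d (reg d) * h w := by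
      intro w
      rw [armInfluence, aipw_eq]
      ring
    simp only [he]
    rw [integral_sub (i4.const_mul _) (i3.const_mul _), integral_const_mul, integral_const_mul,
      integral_add i1 i2, h1, h2]
    ring
  have hmul : ∀ d, Integrable (fun w => armInfluence P B π d (reg d) w * h w) P := fun d =>
    (memLp_armInfluence hB hπ hη hπ_ge hP (hreg d)).integrable_mul hQ.memLp_score
  simp only [sub_mul]
  rw [integral_sub (hmul true) (hmul false), hscore, hscore]
  refine (((hd true).const_mul (p true)⁻¹).sub ((hd false).const_mul (p false)⁻¹)).congr' ?_
  filter_upwards [hQ.mem_model] with t ht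
  rw [functional_eq hB hπ hη hπ_ge _ ht, functional_eq hB hπ hη hπ_ge _ hP]
  ring

end Influence

section Truncation

/-- Truncation of a real number at level `n`. -/
noncomputable def truncate (n : ℕ) (x : ℝ) : ℝ := if |x| ≤ n then x else 0

@[fun_prop]
lemma measurable_truncate (n : ℕ) : Measurable (truncate n) :=
  Measurable.ite (measurableSet_le measurable_id.abs measurable_const) measurable_id
    measurable_const

lemma abs_truncate_le (n : ℕ) (x : ℝ) : |truncate n x| ≤ n := by
  unfold truncate
  split_ifs with h
  · exact h
  · simp

lemma truncate_eq {n : ℕ} {x : ℝ} (h : |x| ≤ n) : truncate n x = x := if_pos h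

lemma tendsto_eLpNorm_truncate_sub {E : Type*} [MeasurableSpace E] {P : Measure E} {g : E → ℝ}
    (hg : Measurable g) (hgL : MemLp g 2 P) :
    Tendsto (fun n : ℕ => eLpNorm (fun w => truncate n (g w) - g w) 2 P) atTop (𝓝 0) := by
  have hL : ∀ n : ℕ, MemLp (fun w => truncate n (g w) - g w) 2 P := fun n =>
    hgL.of_le_mul (c := 1) (Measurable.aestronglyMeasurable (by fun_prop)) (ae_of_all _ fun w => by
      unfold truncate
      split_ifs <;> simp)
  have h : ∀ n : ℕ, eLpNorm (fun w => truncate n (g w) - g w) 2 P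
      = ENNReal.ofReal ((∫ w in {w | (n : ℝ) < |g w|}, g w ^ 2 ∂P) ^ (2 : ℝ)⁻¹) := by
    intro n
    rw [(hL n).eLpNorm_eq_integral_rpow_norm two_ne_zero ENNReal.ofNat_ne_top,
      ENNReal.toReal_ofNat, ← integral_indicator (measurableSet_lt measurable_const hg.abs)]
    congr 2
    refine integral_congr_ae (ae_of_all _ fun w => ?_)
    simp only [truncate, Set.indicator_apply, Set.mem_ofPred_eq, ← not_le]
    split_ifs <;> simp
  simp only [h]
  have h0 := (tendsto_setIntegral_abs_gt hgL hg).rpow_const (p := (2 : ℝ)⁻¹) (Or.inr (by norm_num))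
  simpa using ENNReal.tendsto_ofReal h0

end Truncation

section TangentSpace

variable {k l : ℕ} {B : Set ℝ} {c : ℝ} {π : (Fin k → ℝ) → ℝ} {η : ℝ} {P : Measure (Obs k l)}
  {d : Bool} {f : Feat k l → ℝ} {reg : Bool → Feat k l → ℝ}

lemma eLpNorm_restrict_le_of_condExp {E : Type*} {m m0 : MeasurableSpace E} {Q : Measure E}
    [IsFiniteMeasure Q] {s : Set E} {Y Z e f : E → ℝ} (hY : MemLp Y 2 Q) (hZ : MemLp Z 2 Q)
    (he : e =ᵐ[Q[|s]] (Q[|s])[Y | m]) (hf : f =ᵐ[Q[|s]] (Q[|s])[Z | m]) :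
    eLpNorm (e - f) 2 (Q.restrict s) ≤ eLpNorm (Y - Z) 2 (Q.restrict s) := by
  by_cases hs : Q s = 0
  · simp [Measure.restrict_eq_zero.2 hs]
  have : Q.restrict s = Q s • Q[|s] := by
    rw [ProbabilityTheory.cond, smul_smul, ENNReal.mul_inv_cancel hs (measure_ne_top _ _), one_smul]
  rw [this, eLpNorm_smul_measure_of_ne_top ENNReal.ofNat_ne_top,
    eLpNorm_smul_measure_of_ne_top ENNReal.ofNat_ne_top]
  refine mul_le_mul_right ?_ _
  have hYi := (MemLp.cond (hY.restrict s)).integrable one_le_two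
  have hZi := (MemLp.cond (hZ.restrict s)).integrable one_le_two
  rw [eLpNorm_congr_ae ((he.sub hf).trans (condExp_sub hYi hZi m).symm)]
  exact eLpNorm_condExp_le_eLpNorm _ one_le_two

/-- The value of the arm indicators on the arm `d`. -/
def armPoint (d : Bool) : ℝ × ℝ := if d then (1, 0) else (0, 1)

lemma extendedFeat_eq_of_mem_arm {w : Obs k l} (hw : w ∈ arm B d) :
    extendedFeat B w = (w.feat, armPoint d) := by
  obtain ⟨h1, h2⟩ := hw
  cases d <;> simp [extendedFeat, armPoint, armIndicator, arm, h1, h2]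

lemma annotationIndicator_mul_self (w : Obs k l) :
    annotationIndicator w * annotationIndicator w = annotationIndicator w := by
  unfold annotationIndicator; split_ifs <;> norm_num

/-- The inverse propensity weighted function built from the outcome `y` and imputations `e`. -/
noncomputable def armApprox (P : Measure (Obs k l)) (B : Set ℝ) (π : (Fin k → ℝ) → ℝ) (d : Bool)
    (y : Obs k l → ℝ) (e : Feat k l → ℝ) (w : Obs k l) : ℝ :=
  (P.real (arm B d))⁻¹ * (armIndicator B d w * e w.feat
      * (1 - annotationIndicator w / π w.covariates)
    + armIndicator B d w * (annotationIndicator w / π w.covariates) * y w)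

lemma measurable_armApprox (hB : MeasurableSet B) (hπ : Measurable π) {y : Obs k l → ℝ}
    {e : Feat k l → ℝ} (hy : Measurable y) (he : Measurable e) :
    Measurable (armApprox P B π d y e) := by
  have := measurable_armIndicator (k := k) (l := l) hB d
  unfold armApprox
  fun_prop

lemma abs_armApprox_le (hη : 0 < η) (hπ_ge : ∀ x, η ≤ π x) {y : Obs k l → ℝ}
    {e : Feat k l → ℝ} {C : ℝ} (hy : ∀ w, |y w| ≤ C) (he : ∀ x, |e x| ≤ C) (w : Obs k l) :
    |armApprox P B π d y e w| ≤ (P.real (arm B d))⁻¹ * (C * (1 + η⁻¹) + η⁻¹ * C) := by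
  have hC : 0 ≤ C := (abs_nonneg _).trans (hy w)
  have hA0 := armIndicator_nonneg B d w
  have hA1 := armIndicator_le_one B d w
  have h1 := abs_one_sub_annotationIndicator_div_le hη hπ_ge w
  have h2 := abs_annotationIndicator_div_le hη hπ_ge w
  have h3 : |armIndicator B d w * e w.feat| ≤ C := by
    rw [abs_mul, abs_of_nonneg hA0]
    simpa using mul_le_mul hA1 (he w.feat) (abs_nonneg _) zero_le_one
  have h4 : |armIndicator B d w * (annotationIndicator w / π w.covariates)| ≤ η⁻¹ := by
    rw [abs_mul, abs_of_nonneg hA0]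
    simpa using mul_le_mul hA1 h2 (abs_nonneg _) zero_le_one
  unfold armApprox
  rw [abs_mul, abs_of_nonneg (inv_nonneg.2 measureReal_nonneg)]
  refine mul_le_mul_of_nonneg_left ((abs_add_le _ _).trans (add_le_add ?_ ?_))
    (inv_nonneg.2 measureReal_nonneg)
  · rw [abs_mul]
    exact mul_le_mul h3 h1 (abs_nonneg _) hC
  · rw [abs_mul]
    exact mul_le_mul h4 (hy w) (abs_nonneg _) (inv_nonneg.2 hη.le)

lemma setIntegral_armApprox_mul_score (hB : MeasurableSet B) (hπ : Measurable π) (hη : 0 < η)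
    (hπ_ge : ∀ x, η ≤ π x) (hπ1 : ∀ x, π x ≤ 1) (hP : P ∈ annotationModel B c π)
    {y : Obs k l → ℝ} {e : Feat k l → ℝ} (hy : Measurable y) (he : Measurable e) {C : ℝ}
    (hyC : ∀ w, |y w| ≤ C) (heC : ∀ x, |e x| ≤ C)
    (hey : (fun w => e w.feat) =ᵐ[P[|arm B d ∩ annotated]]
      (P[|arm B d ∩ annotated])[y | MeasurableSpace.comap Obs.feat inferInstance])
    {S : Set (Feat k l × ℝ × ℝ)} (hS : MeasurableSet S) :
    ∫ w in extendedFeat B ⁻¹' S, armApprox P B π d y e w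
      * (annotationIndicator w - π w.covariates) ∂P = 0 := by
  have hP1 := hP.1
  have hπ0 : ∀ x, 0 < π x := fun x => hη.trans_le (hπ_ge x)
  have hA := measurable_armIndicator (k := k) (l := l) hB d
  have hE := measurable_extendedFeat (k := k) (l := l) hB
  let F : Feat k l × ℝ × ℝ → ℝ := fun x => S.indicator (fun _ => 1) x * (selectArm d x * e x.1) *
    π x.1.1
  have hF : Measurable F := by
    have : Measurable (S.indicator (fun _ => (1 : ℝ))) := measurable_const.indicator hS
    fun_prop
  have hFi : Integrable (fun w => F (extendedFeat B w)) P := by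
    refine Integrable.of_bound (C := C) (hF.comp hE).aestronglyMeasurable (ae_of_all _ fun w => ?_)
    have hC : 0 ≤ C := (abs_nonneg _).trans (hyC w)
    simp only [F, selectArm_extendedFeat, extendedFeat_fst, norm_mul, feat_fst]
    rw [Real.norm_of_nonneg (armIndicator_nonneg B d w), Real.norm_of_nonneg (hπ0 _).le]
    have h1 : ‖S.indicator (fun _ => (1 : ℝ)) (extendedFeat B w)‖ ≤ 1 := by
      refine (norm_indicator_le_norm_self _ _).trans (by simp)
    calc _ ≤ 1 * (1 * C) * 1 := by
          gcongr
          · exact (hπ0 _).le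
          · exact mul_nonneg (armIndicator_nonneg B d w) (norm_nonneg _)
          · exact armIndicator_le_one B d w
          · exact heC _
          · exact hπ1 _
      _ = C := by ring
  have h1 := integral_mul_ipw_eq_zero hB hπ hη hπ_ge hP hF hFi
  let T : Set (Feat k l) := {x | (x, armPoint d) ∈ S}
  have hT : MeasurableSet T := hS.preimage (by fun_prop)
  let g : Feat k l → ℝ := fun x => T.indicator (fun _ => 1) x * ((π x.1)⁻¹ - 1)
  have hg : Measurable g := by
    have : Measurable (T.indicator (fun _ => (1 : ℝ))) := measurable_const.indicator hT
    fun_prop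
  have hgC : ∀ x, |g x| ≤ η⁻¹ + 1 := by
    intro x
    have h1 : |T.indicator (fun _ => (1 : ℝ)) x| ≤ 1 := by
      rw [← Real.norm_eq_abs]
      exact (norm_indicator_le_norm_self _ _).trans (by simp)
    have h2 : |(π x.1)⁻¹ - 1| ≤ η⁻¹ + 1 := by
      refine (abs_sub _ _).trans ?_
      rw [abs_one, abs_of_pos (inv_pos.2 (hπ0 _))]
      gcongr
      exact hπ_ge _
    rw [abs_mul]
    simpa using mul_le_mul h1 h2 (abs_nonneg _) zero_le_one
  have hyL : MemLp y 2 P := MemLp.of_bound hy.aestronglyMeasurable C (ae_of_all _ hyC)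
  have h2 := integral_arm_mul_condExp hB hyL hey hg hgC
  have hbdd : ∀ z : Obs k l → ℝ, Measurable z → (∀ w, |z w| ≤ C) →
      Integrable (fun w => armIndicator B d w * annotationIndicator w * (g w.feat * z w)) P := by
    intro z hz hzC
    have hgf : Measurable fun w : Obs k l => g w.feat := hg.comp Obs.measurable_feat
    refine Integrable.of_bound (C := 1 * 1 * ((η⁻¹ + 1) * C))
      (Measurable.aestronglyMeasurable (by fun_prop)) (ae_of_all _ fun w => ?_)
    have hC : 0 ≤ C := (abs_nonneg _).trans (hyC w)
    simp only [norm_mul]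
    rw [Real.norm_of_nonneg (armIndicator_nonneg B d w),
      Real.norm_of_nonneg (annotationIndicator_nonneg w)]
    gcongr
    · exact annotationIndicator_nonneg w
    · exact armIndicator_le_one B d w
    · exact annotationIndicator_le_one w
    · exact hgC _
    · exact hzC _
  have hb1 := hbdd y hy hyC
  have hb2 := hbdd (fun w => e w.feat) (he.comp Obs.measurable_feat) (fun w => heC _)
  have h3 : Integrable (fun w => F (extendedFeat B w)
      * (1 - annotationIndicator w / π w.covariates)) P := by
    exact memLp_one_iff_integrable.1 (memLp_mul_one_sub hπ hη hπ_ge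
      (memLp_one_iff_integrable.2 hFi))
  have hpt : ∀ w, (extendedFeat B ⁻¹' S).indicator (fun w => armApprox P B π d y e w
      * (annotationIndicator w - π w.covariates)) w
      = (P.real (arm B d))⁻¹ * ((armIndicator B d w * annotationIndicator w * (g w.feat * y w)
          - armIndicator B d w * annotationIndicator w * (g w.feat * e w.feat))
        - F (extendedFeat B w) * (1 - annotationIndicator w / π w.covariates)) := by
    intro w
    by_cases hw : w ∈ arm B d
    · have h0 := (hπ0 w.covariates).ne'
      have ha := annotationIndicator_mul_self w
      have hE' := extendedFeat_eq_of_mem_arm hw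
      have hmem : w ∈ extendedFeat B ⁻¹' S ↔ w.feat ∈ T := by
        simp [T, Set.mem_preimage, hE']
      have hmem' : extendedFeat B w ∈ S ↔ w.feat ∈ T := hmem
      have hA1 : armIndicator B d w = 1 := by simp [armIndicator, hw]
      by_cases hwT : w.feat ∈ T
      · rw [Set.indicator_of_mem (hmem.2 hwT)]
        simp only [F, g, Set.indicator_of_mem hwT, Set.indicator_of_mem (hmem'.2 hwT),
          selectArm_extendedFeat, extendedFeat_fst, hA1, armApprox, feat_fst]
        field_simp
        linear_combination (P.real (arm B d))⁻¹ * (y w - e w.feat) * ha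
      · rw [Set.indicator_of_notMem (mt hmem.1 hwT)]
        simp [F, g, Set.indicator_of_notMem hwT, Set.indicator_of_notMem (mt hmem'.1 hwT)]
    · have hA0 : armIndicator B d w = 0 := by simp [armIndicator, hw]
      have : armApprox P B π d y e w = 0 := by simp [armApprox, hA0]
      simp [F, this, hA0]
  rw [← integral_indicator (hE hS)]
  simp only [hpt]
  have hb3 : Integrable (fun w => armIndicator B d w * annotationIndicator w * (g w.feat * y w)
      - armIndicator B d w * annotationIndicator w * (g w.feat * e w.feat)) P := hb1.sub hb2
  rw [integral_const_mul, integral_sub hb3 h3, integral_sub hb1 hb2, h1, h2]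
  simp

lemma eLpNorm_armApprox_sub_aipw_le (hB : MeasurableSet B) (hπ : Measurable π) (hη : 0 < η)
    (hπ_ge : ∀ x, η ≤ π x) (hP : P ∈ annotationModel B c π) (hf : IsRegressionFunction P B d f)
    {y : Obs k l → ℝ} {e : Feat k l → ℝ} (hy : Measurable y) (hyL : MemLp y 2 P)
    (he : Measurable e)
    (hey : (fun w => e w.feat) =ᵐ[P[|arm B d ∩ annotated]]
      (P[|arm B d ∩ annotated])[y | MeasurableSpace.comap Obs.feat inferInstance]) :
    eLpNorm (fun w => armApprox P B π d y e w - aipw P B π d f w) 2 P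
      ≤ (ENNReal.ofReal ((P.real (arm B d))⁻¹ * (1 + η⁻¹)) * ENNReal.ofReal η⁻¹ ^ (1 / 2 : ℝ)
          + ENNReal.ofReal ((P.real (arm B d))⁻¹ * η⁻¹))
        * eLpNorm (fun w => y w - w.outcome) 2 P := by
  have hP1 := hP.1
  have hA := measurable_armIndicator (k := k) (l := l) hB d
  have hfm := hf.1
  have hp : 0 ≤ (P.real (arm B d))⁻¹ := inv_nonneg.2 measureReal_nonneg
  have hsplit : (fun w => armApprox P B π d y e w - aipw P B π d f w)
      = (fun w => (P.real (arm B d))⁻¹ * (armIndicator B d w * (e - f) w.feat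
          * (1 - annotationIndicator w / π w.covariates)))
        + fun w => (P.real (arm B d))⁻¹ * (armIndicator B d w
          * (annotationIndicator w / π w.covariates) * (y w - w.outcome)) := by
    ext w
    rw [aipw_eq]
    simp only [armApprox, ipwOutcome, Pi.add_apply, Pi.sub_apply]
    ring
  have hef : Measurable fun w : Obs k l => (e - f) w.feat :=
    (he.sub hfm).comp Obs.measurable_feat
  rw [hsplit, add_mul]
  refine (eLpNorm_add_le (Measurable.aestronglyMeasurable (by fun_prop))
    (Measurable.aestronglyMeasurable (by fun_prop)) one_le_two).trans (add_le_add ?_ ?_)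
  · refine (eLpNorm_le_mul_eLpNorm_of_ae_le_mul (g := fun w => armIndicator B d w * (e - f) w.feat)
      (c := (P.real (arm B d))⁻¹ * (1 + η⁻¹)) (ae_of_all _ fun w => ?_) 2).trans ?_
    · rw [norm_mul, norm_mul (armIndicator B d w * (e - f) w.feat), Real.norm_of_nonneg hp,
        mul_assoc, mul_comm (‖armIndicator B d w * (e - f) w.feat‖)]
      gcongr
      exact abs_one_sub_annotationIndicator_div_le hη hπ_ge w
    · rw [mul_assoc]
      refine mul_le_mul_right ?_ _
      refine (eLpNorm_armIndicator_mul_le hB hπ hη hπ_ge hP (he.sub hfm)).trans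
        (mul_le_mul_right ?_ _)
      refine (eLpNorm_restrict_le_of_condExp hyL hP.2.1 hey hf.2).trans ?_
      exact eLpNorm_mono_measure _ Measure.restrict_le_self
  · refine eLpNorm_le_mul_eLpNorm_of_ae_le_mul (ae_of_all _ fun w => ?_) 2
    rw [norm_mul, norm_mul, Real.norm_of_nonneg hp, mul_assoc]
    gcongr
    rw [norm_mul, Real.norm_of_nonneg (armIndicator_nonneg B d w), Real.norm_eq_abs]
    simpa only [one_mul] using mul_le_mul (armIndicator_le_one B d w) (abs_annotationIndicator_div_le hη hπ_ge w)
      (abs_nonneg _) zero_le_one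

lemma exists_bounded_approx (hB : MeasurableSet B) (hπ : Measurable π) (hη : 0 < η)
    (hπ_ge : ∀ x, η ≤ π x) (hπ1 : ∀ x, π x ≤ 1) (hP : P ∈ annotationModel B c π)
    (hf : IsRegressionFunction P B d f) :
    ∃ b : ℕ → Obs k l → ℝ, (∀ n, Measurable (b n)) ∧ (∀ n, ∃ C, ∀ w, |b n w| ≤ C) ∧
      (∀ n S, MeasurableSet S → ∫ w in extendedFeat B ⁻¹' S,
        b n w * (annotationIndicator w - π w.covariates) ∂P = 0) ∧
      Tendsto (fun n => eLpNorm (fun w => b n w - aipw P B π d f w) 2 P) atTop (𝓝 0) := by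
  have hP1 := hP.1
  have he : ∀ n : ℕ, ∃ e : Feat k l → ℝ, Measurable e ∧ (∀ x, |e x| ≤ n) ∧
      (fun w => e w.feat) =ᵐ[P[|arm B d ∩ annotated]]
        (P[|arm B d ∩ annotated])[fun w => truncate n w.outcome |
          MeasurableSpace.comap Obs.feat inferInstance] := by
    intro n
    obtain ⟨e, he, hee⟩ := (stronglyMeasurable_condExp (m := MeasurableSpace.comap Obs.feat
      inferInstance) (μ := P[|arm B d ∩ annotated])
      (f := fun w : Obs k l => truncate n w.outcome)).exists_eq_measurable_comp
    refine ⟨fun x => truncate n (e x), (measurable_truncate n).comp he.measurable,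
      fun x => abs_truncate_le n _, ?_⟩
    have hb := ae_bdd_abs_condExp_of_ae_bdd_abs (m := MeasurableSpace.comap Obs.feat inferInstance)
      (μ := P[|arm B d ∩ annotated]) (R := (n : ℝ)) (f := fun w : Obs k l => truncate n w.outcome)
      (ae_of_all _ fun w => abs_truncate_le n _)
    filter_upwards [hb] with w hw
    rw [hee] at hw ⊢
    exact truncate_eq hw
  choose e hem heb hey using he
  have hym : ∀ n : ℕ, Measurable fun w : Obs k l => truncate n w.outcome := fun n => by fun_prop
  have hyL : ∀ n : ℕ, MemLp (fun w : Obs k l => truncate n w.outcome) 2 P := fun n =>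
    MemLp.of_bound (hym n).aestronglyMeasurable n (ae_of_all _ fun w => abs_truncate_le n _)
  refine ⟨fun n => armApprox P B π d (fun w => truncate n w.outcome) (e n),
    fun n => measurable_armApprox hB hπ (hym n) (hem n),
    fun n => ⟨_, abs_armApprox_le hη hπ_ge (fun w => abs_truncate_le n _) (heb n)⟩,
    fun n S hS => setIntegral_armApprox_mul_score hB hπ hη hπ_ge hπ1 hP (hym n) (hem n)
      (fun w => abs_truncate_le n _) (heb n) (hey n) hS, ?_⟩
  refine tendsto_of_tendsto_of_tendsto_of_le_of_le tendsto_const_nhds ?_ (fun _ => zero_le)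
    (fun n => eLpNorm_armApprox_sub_aipw_le hB hπ hη hπ_ge hP hf (hym n) (hyL n) (hem n) (hey n))
  have h := ENNReal.Tendsto.const_mul (tendsto_eLpNorm_truncate_sub Obs.measurable_outcome hP.2.1)
    (a := ENNReal.ofReal ((P.real (arm B d))⁻¹ * (1 + η⁻¹)) * ENNReal.ofReal η⁻¹ ^ (1 / 2 : ℝ)
          + ENNReal.ofReal ((P.real (arm B d))⁻¹ * η⁻¹)) (Or.inr ?_)
  · simpa using h
  · exact ENNReal.add_ne_top.2 ⟨ENNReal.mul_ne_top ENNReal.ofReal_ne_top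
      (ENNReal.rpow_lt_top_of_nonneg (by norm_num) ENNReal.ofReal_ne_top).ne, ENNReal.ofReal_ne_top⟩

lemma eLpNorm_sub_integral_le {E : Type*} [MeasurableSpace E] {P : Measure E}
    [IsProbabilityMeasure P] {G : E → ℝ} (hG : MemLp G 2 P) :
    eLpNorm (fun w => G w - ∫ w', G w' ∂P) 2 P ≤ 2 * eLpNorm G 2 P := by
  have h1 : eLpNorm (fun _ : E => ∫ w', G w' ∂P) 2 P ≤ eLpNorm G 2 P := by
    rw [eLpNorm_const _ two_ne_zero (IsProbabilityMeasure.ne_zero P), measure_univ,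
      ENNReal.one_rpow, mul_one]
    refine (enorm_integral_le_lintegral_enorm G).trans ?_
    rw [← eLpNorm_one_eq_lintegral_enorm]
    exact eLpNorm_le_eLpNorm_of_exponent_le one_le_two hG.1
  rw [two_mul]
  exact (eLpNorm_sub_le hG.1 aestronglyMeasurable_const one_le_two).trans (add_le_add le_rfl h1)

/-- The influence function belongs to the tangent space. -/
lemma toLp_influence_mem_tangentSpace (hB : MeasurableSet B) (hπ : Measurable π) (hη : 0 < η)
    (hπ_ge : ∀ x, η ≤ π x) (hπ1 : ∀ x, π x ≤ 1) (hP : P ∈ annotationModel B c π)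
    (hreg : ∀ d, IsRegressionFunction P B d (reg d))
    (hL : MemLp (fun w => armInfluence P B π true (reg true) w
      - armInfluence P B π false (reg false) w) 2 P) :
    hL.toLp _ ∈ tangentSpace (annotationModel B c π) Obs.outcome P := by
  have hP1 := hP.1
  have hπ0 : ∀ x, 0 ≤ π x := fun x => hη.le.trans (hπ_ge x)
  choose b hbm hbC hbS hbL using fun d => exists_bounded_approx hB hπ hη hπ_ge hπ1 hP (hreg d)
  choose C hC using hbC
  have hbLp : ∀ d n, MemLp (b d n) 2 P := fun d n =>
    MemLp.of_bound (hbm d n).aestronglyMeasurable (C d n) (ae_of_all _ (hC d n))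
  have hAL := fun d => memLp_aipw hB hπ hη hπ_ge hP (hreg d)
  set h : ℕ → Obs k l → ℝ := fun n w => b true n w - b false n w
    - ∫ w', (b true n w' - b false n w') ∂P with hh
  have hdL : ∀ n, MemLp (fun w => b true n w - b false n w) 2 P := fun n =>
    (hbLp true n).sub (hbLp false n)
  have hhm : ∀ n, Measurable (h n) := fun n =>
    ((hbm true n).sub (hbm false n)).sub measurable_const
  have hhC : ∀ n w, |h n w| ≤ C true n + C false n + |∫ w', (b true n w' - b false n w') ∂P| :=
    fun n w => (abs_sub _ _).trans (add_le_add ((abs_sub _ _).trans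
      (add_le_add (hC true n w) (hC false n w))) le_rfl)
  have hh0 : ∀ n, ∫ w, h n w ∂P = 0 := fun n => by
    simp only [hh]
    rw [integral_sub ((hdL n).integrable one_le_two) (integrable_const _)]
    simp
  have hscore : ∀ n S, MeasurableSet S → ∫ w in extendedFeat B ⁻¹' S,
      h n w * (annotationIndicator w - π w.covariates) ∂P = 0 := by
    intro n S hS
    have h1 : Integrable (fun w : Obs k l => annotationIndicator w - π w.covariates) P := by
      refine Integrable.of_bound (C := 1) (Measurable.aestronglyMeasurable (by fun_prop))
        (ae_of_all _ fun w => ?_)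
      rw [Real.norm_eq_abs, abs_le]
      constructor <;> linarith [annotationIndicator_nonneg w, annotationIndicator_le_one w,
        hπ0 w.covariates, hπ1 w.covariates]
    have h2 : ∀ d, Integrable (fun w => b d n w * (annotationIndicator w - π w.covariates)) P :=
      fun d => h1.bdd_mul (hbm d n).aestronglyMeasurable (ae_of_all _ (hC d n))
    have h3 := (score_iff hB hπ hπ0 hπ1).1 hP.2.2.2.2 S hS
    have h4 : ∀ w, h n w * (annotationIndicator w - π w.covariates)
        = b true n w * (annotationIndicator w - π w.covariates)
          - b false n w * (annotationIndicator w - π w.covariates)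
          - (∫ w', (b true n w' - b false n w') ∂P)
            * (annotationIndicator w - π w.covariates) := fun w => by simp only [hh]; ring
    simp only [h4]
    have h5 : Integrable (fun w => b true n w * (annotationIndicator w - π w.covariates)
        - b false n w * (annotationIndicator w - π w.covariates)) P := (h2 true).sub (h2 false)
    rw [integral_sub h5.restrict (h1.const_mul _).restrict,
      integral_sub (h2 true).restrict (h2 false).restrict, integral_const_mul, hbS true n S hS,
      hbS false n S hS, h3]
    simp
  have hhL : ∀ n, MemLp (h n) 2 P := fun n => (hdL n).sub (memLp_const _)
  refine (Submodule.isClosed_topologicalClosure _).mem_of_tendsto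
    (f := fun n => (hhL n).toLp (h n)) (b := atTop) ?_ (Eventually.of_forall fun n =>
      toLp_mem_tangentSpace hB hπ hπ0 hπ1 hP (hhm n) (hhC n) (hh0 n) (hscore n) (hhL n))
  rw [Lp.tendsto_Lp_iff_tendsto_eLpNorm'']
  have hGL : ∀ d n, MemLp (fun w => b d n w - aipw P B π d (reg d) w) 2 P := fun d n =>
    (hbLp d n).sub (hAL d)
  have hbound : ∀ n, eLpNorm (h n - fun w => armInfluence P B π true (reg true) w
      - armInfluence P B π false (reg false) w) 2 P
      ≤ 2 * (eLpNorm (fun w => b true n w - aipw P B π true (reg true) w) 2 P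
        + eLpNorm (fun w => b false n w - aipw P B π false (reg false) w) 2 P) := by
    intro n
    have h1 : (h n - fun w => armInfluence P B π true (reg true) w
        - armInfluence P B π false (reg false) w)
        = fun w => ((b true n w - aipw P B π true (reg true) w)
            - (b false n w - aipw P B π false (reg false) w))
          - ∫ w', ((b true n w' - aipw P B π true (reg true) w')
            - (b false n w' - aipw P B π false (reg false) w')) ∂P := by
      have i := fun d => (hbLp d n).integrable one_le_two
      have j := fun d => (hAL d).integrable one_le_two
      have e1 := fun d => (integral_aipw hB hπ hη hπ_ge hP (hreg d)).trans
        (armMean_eq hB hπ hη hπ_ge hP (hreg d)).symm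
      have e2 : ∀ d, ∫ w', (b d n w' - aipw P B π d (reg d) w') ∂P
          = ∫ w', b d n w' ∂P - armMean P B d (reg d) := fun d => by
        rw [integral_sub (i d) (j d), e1 d]
      ext w
      rw [integral_sub ((hGL true n).integrable one_le_two) ((hGL false n).integrable one_le_two),
        e2, e2]
      simp only [hh, Pi.sub_apply, armInfluence]
      rw [integral_sub (i true) (i false)]
      ring
    rw [h1]
    refine (eLpNorm_sub_integral_le ((hGL true n).sub (hGL false n))).trans
      (mul_le_mul_right ?_ _)
    exact eLpNorm_sub_le (hGL true n).1 (hGL false n).1 one_le_two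
  refine tendsto_of_tendsto_of_tendsto_of_le_of_le tendsto_const_nhds ?_ (fun _ => zero_le) hbound
  have := ENNReal.Tendsto.const_mul ((hbL true).add (hbL false)) (a := 2) (Or.inr (by simp))
  simpa using this

end TangentSpace

section Sampling

variable {E Ω : Type*} [MeasurableSpace E] [MeasurableSpace Ω] {P : Measure E} {μ : Measure Ω}
  [IsProbabilityMeasure μ] {W : ℕ → Ω → E}

lemma map_sum_eq_of_card_eq {X : ℕ → Ω → ℝ} (hX : iIndepFun X μ)
    (hid : ∀ i, IdentDistrib (X i) (X 0) μ μ) {I J : Finset ℕ} (hIJ : I.card = J.card) :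
    μ.map (fun ω => ∑ i ∈ I, X i ω) = μ.map (fun ω => ∑ i ∈ J, X i ω) := by
  have hm : ∀ i, AEMeasurable (X i) μ := fun i => (hid i).aemeasurable_fst
  have := Measure.isProbabilityMeasure_map (Finset.aemeasurable_fun_sum I fun i _ => hm i)
  have := Measure.isProbabilityMeasure_map (Finset.aemeasurable_fun_sum J fun i _ => hm i)
  refine Measure.ext_of_charFun ?_
  rw [(hX.restrict I).charFun_map_fun_finsetSum_eq_prod (fun i _ => hm i),
    (hX.restrict J).charFun_map_fun_finsetSum_eq_prod (fun i _ => hm i)]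
  simp only [fun i => (hid i).map_eq, Finset.prod_const, hIJ]

/-- The central limit theorem along index sets of growing size. -/
lemma tendstoInDistribution_sum_finset (hW : ∀ i, HasLaw (W i) P μ) (hind : iIndepFun W μ)
    {φ : E → ℝ} (hφ : Measurable φ) (hφL : MemLp φ 2 P) (hφ0 : ∫ w, φ w ∂P = 0)
    {I : ℕ → Finset ℕ} (hI : Tendsto (fun n => (I n).card) atTop atTop) :
    TendstoInDistribution (fun n ω => (√((I n).card : ℝ))⁻¹ * ∑ i ∈ I n, φ (W i ω)) atTop
      (id : ℝ → ℝ) (fun _ => μ) (gaussianReal 0 (Var[φ; P]).toNNReal) := by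
  set X : ℕ → Ω → ℝ := fun i ω => φ (W i ω) with hX
  have hidP : ∀ i, IdentDistrib (X i) φ μ P := fun i =>
    ((hW i).identDistrib ⟨aemeasurable_id, Measure.map_id⟩).comp hφ
  have hid : ∀ i, IdentDistrib (X i) (X 0) μ μ := fun i => (hidP i).trans (hidP 0).symm
  have hXi : iIndepFun X μ := hind.comp (fun _ => φ) (fun _ => hφ)
  have hm : ∀ i, AEMeasurable (X i) μ := fun i => (hid i).aemeasurable_fst
  have hY : HasLaw (id : ℝ → ℝ) (gaussianReal 0 (Var[X 0; μ]).toNNReal)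
      (gaussianReal 0 (Var[φ; P]).toNNReal) :=
    ⟨aemeasurable_id, by rw [Measure.map_id, (hidP 0).variance_eq]⟩
  have h := tendstoInDistribution_inv_sqrt_mul_sum_sub hY ((hidP 0).memLp_iff.2 hφL) hXi hid
  have hmean : ∫ ω, X 0 ω ∂μ = 0 := (hidP 0).integral_eq.trans hφ0
  simp only [hmean, mul_zero, sub_zero] at h
  refine ⟨fun n => (Finset.aemeasurable_fun_sum _ fun i _ => hm i).const_mul _, aemeasurable_id, ?_⟩
  refine (h.tendsto.comp hI).congr fun n => ?_
  refine Subtype.ext ?_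
  have h1 : ∀ J : Finset ℕ, μ.map (fun ω => (√((I n).card : ℝ))⁻¹ * ∑ i ∈ J, X i ω)
      = (μ.map (fun ω => ∑ i ∈ J, X i ω)).map (fun x => (√((I n).card : ℝ))⁻¹ * x) := fun J =>
    (AEMeasurable.map_map_of_aemeasurable (by fun_prop)
      (Finset.aemeasurable_fun_sum _ fun i _ => hm i)).symm
  change μ.map _ = μ.map _
  rw [h1, h1, map_sum_eq_of_card_eq hXi hid (Finset.card_range _)]

lemma lintegral_normalized_sum_sq_le (hW : ∀ i, HasLaw (W i) P μ) (hind : iIndepFun W μ)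
    {ρ : E → ℝ} (hρ : Measurable ρ) (hρL : MemLp ρ 2 P) (hρ0 : ∫ w, ρ w ∂P = 0) (I : Finset ℕ) :
    ∫⁻ ω, ENNReal.ofReal (((√(I.card : ℝ))⁻¹ * ∑ i ∈ I, ρ (W i ω)) ^ 2) ∂μ
      ≤ ∫⁻ w, ENNReal.ofReal (ρ w ^ 2) ∂P := by
  set X : ℕ → Ω → ℝ := fun i ω => ρ (W i ω) with hX
  have hidP : ∀ i, IdentDistrib (X i) ρ μ P := fun i =>
    ((hW i).identDistrib ⟨aemeasurable_id, Measure.map_id⟩).comp hρ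
  have hXi : iIndepFun X μ := hind.comp (fun _ => ρ) (fun _ => hρ)
  have hXL : ∀ i, MemLp (X i) 2 μ := fun i => (hidP i).memLp_iff.2 hρL
  have hX0 : ∀ i, ∫ ω, X i ω ∂μ = 0 := fun i => (hidP i).integral_eq.trans hρ0
  have hSL : MemLp (∑ i ∈ I, X i) 2 μ := memLp_finsetSum' I fun i _ => hXL i
  have hS0 : ∫ ω, (∑ i ∈ I, X i) ω ∂μ = 0 := by
    simp only [Finset.sum_apply]
    rw [integral_finsetSum _ fun i _ => (hXL i).integrable one_le_two]
    simp [hX0]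
  have hvar : ∫ ω, (∑ i ∈ I, X i) ω ^ 2 ∂μ = I.card * ∫ w, ρ w ^ 2 ∂P := by
    rw [← variance_of_integral_eq_zero hSL.1.aemeasurable hS0,
      IndepFun.variance_sum (fun i _ => hXL i) (fun i _ j _ hij => hXi.indepFun hij),
      Finset.sum_congr rfl fun i _ => (hidP i).variance_eq,
      variance_of_integral_eq_zero hρ.aemeasurable hρ0]
    simp
  have h1 : Integrable (fun ω => ((√(I.card : ℝ))⁻¹ * (∑ i ∈ I, X i) ω) ^ 2) μ :=
    (hSL.const_mul _).integrable_sq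
  have h2 : ∀ ω, ∑ i ∈ I, ρ (W i ω) = (∑ i ∈ I, X i) ω := fun ω => by simp [hX]
  simp only [h2]
  rw [← ofReal_integral_eq_lintegral_ofReal h1 (ae_of_all _ fun _ => sq_nonneg _),
    ← ofReal_integral_eq_lintegral_ofReal hρL.integrable_sq (ae_of_all _ fun _ => sq_nonneg _)]
  refine ENNReal.ofReal_le_ofReal ?_
  simp only [mul_pow]
  rw [integral_const_mul, hvar, inv_pow, Real.sq_sqrt (Nat.cast_nonneg _), ← mul_assoc]
  refine mul_le_of_le_one_left (integral_nonneg fun _ => sq_nonneg _) ?_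
  exact inv_mul_le_one

/-- Conditionally on the training sample, a second moment over the estimation sample can be
computed as if the training sample were fixed. -/
lemma lintegral_crossfit_le (hW : ∀ i, AEMeasurable (W i) μ) (hind : iIndepFun W μ)
    {I J : Finset ℕ} (hIJ : Disjoint I J) {r : (J → E) → E → ℝ}
    (hr : Measurable (Function.uncurry r)) (a : ℝ) {b : (J → E) → ℝ≥0∞} (hb : Measurable b)
    (hle : ∀ τ, ∫⁻ ω, ENNReal.ofReal ((a * ∑ i ∈ I, r τ (W i ω)) ^ 2) ∂μ ≤ b τ) :
    ∫⁻ ω, ENNReal.ofReal ((a * ∑ i ∈ I, r (fun j => W j ω) (W i ω)) ^ 2) ∂μ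
      ≤ ∫⁻ ω, b (fun j => W j ω) ∂μ := by
  let T : Ω → J → E := fun ω j => W j ω
  let V : Ω → I → E := fun ω i => W i ω
  have hT : AEMeasurable T μ := aemeasurable_pi_iff.2 fun j => hW j
  have hV : AEMeasurable V μ := aemeasurable_pi_iff.2 fun i => hW i
  let G : (J → E) × (I → E) → ℝ≥0∞ := fun x =>
    ENNReal.ofReal ((a * ∑ i : I, r x.1 (x.2 i)) ^ 2)
  have hG : Measurable G := by
    have : ∀ i : I, Measurable fun x : (J → E) × (I → E) => r x.1 (x.2 i) := fun i =>
      hr.comp (measurable_fst.prodMk ((measurable_pi_apply i).comp measurable_snd))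
    have h2 : Measurable fun x : (J → E) × (I → E) => ∑ i : I, r x.1 (x.2 i) :=
      Finset.measurable_fun_sum _ fun i _ => this i
    fun_prop
  have hsum : ∀ τ ω, ∑ i : I, r τ (V ω i) = ∑ i ∈ I, r τ (W i ω) := fun τ ω =>
    Finset.sum_coe_sort I fun i => r τ (W i ω)
  have hTV : μ.map (fun ω => (T ω, V ω)) = (μ.map T).prod (μ.map V) :=
    (indepFun_iff_map_prod_eq_prod_map_map hT hV).1 (hind.indepFun_finset₀ J I hIJ.symm hW)
  have := Measure.isProbabilityMeasure_map hV
  calc ∫⁻ ω, ENNReal.ofReal ((a * ∑ i ∈ I, r (fun j => W j ω) (W i ω)) ^ 2) ∂μ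
      = ∫⁻ ω, G (T ω, V ω) ∂μ := by simp only [G, hsum, T]
    _ = ∫⁻ x, G x ∂((μ.map T).prod (μ.map V)) := by
        rw [← hTV, lintegral_map' hG.aemeasurable (hT.prodMk hV)]
    _ = ∫⁻ τ, ∫⁻ v, G (τ, v) ∂(μ.map V) ∂(μ.map T) := lintegral_prod _ hG.aemeasurable
    _ ≤ ∫⁻ τ, b τ ∂(μ.map T) := by
        refine lintegral_mono fun τ => ?_
        rw [lintegral_map' (f := fun v => G (τ, v)) (hG.comp measurable_prodMk_left).aemeasurable hV]
        simpa only [G, hsum] using hle τ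
    _ = ∫⁻ ω, b (fun j => W j ω) ∂μ := lintegral_map' hb.aemeasurable hT

end Sampling

section Estimator

variable {k l : ℕ} {B : Set ℝ} {c : ℝ} {π : (Fin k → ℝ) → ℝ} {η : ℝ} {P : Measure (Obs k l)}
  {reg : Bool → Feat k l → ℝ}

/-- The effect on the estimating function of perturbing the imputation functions by `δ`. -/
noncomputable def imputationError (P : Measure (Obs k l)) (B : Set ℝ) (π : (Fin k → ℝ) → ℝ)
    (δ : Bool → Feat k l → ℝ) (w : Obs k l) : ℝ :=
  (P.real (arm B true))⁻¹ * (armIndicator B true w * δ true w.feat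
      * (1 - annotationIndicator w / π w.covariates))
    - (P.real (arm B false))⁻¹ * (armIndicator B false w * δ false w.feat
      * (1 - annotationIndicator w / π w.covariates))

lemma aipw_sub_aipw_eq_add (f g : Bool → Feat k l → ℝ) (w : Obs k l) :
    aipw P B π true (f true) w - aipw P B π false (f false) w
      = aipw P B π true (g true) w - aipw P B π false (g false) w
        + imputationError P B π (fun d x => f d x - g d x) w := by
  simp only [aipw_eq, imputationError]
  ring

lemma measurable_aipw (hB : MeasurableSet B) (hπ : Measurable π) {d : Bool} {f : Feat k l → ℝ}
    (hf : Measurable f) : Measurable (aipw P B π d f) := by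
  have h1 := measurable_armIndicator (k := k) (l := l) hB d
  have h2 := measurable_ipwOutcome (k := k) (l := l) hB hπ d
  have : aipw P B π d f = _ := funext (aipw_eq P B π d f)
  rw [this]
  fun_prop

/-- The squared error constant. -/
noncomputable def errorConstant (P : Measure (Obs k l)) (B : Set ℝ) (η : ℝ) (d : Bool) : ℝ :=
  2 * ((P.real (arm B d))⁻¹ * (1 + η⁻¹)) ^ 2

lemma imputationError_sq_le (hη : 0 < η) (hπ_ge : ∀ x, η ≤ π x) (δ : Bool → Feat k l → ℝ)
    (w : Obs k l) : imputationError P B π δ w ^ 2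
      ≤ errorConstant P B η true * δ true w.feat ^ 2
        + errorConstant P B η false * δ false w.feat ^ 2 := by
  have h : ∀ d, ((P.real (arm B d))⁻¹ * (armIndicator B d w * δ d w.feat
      * (1 - annotationIndicator w / π w.covariates))) ^ 2
      ≤ ((P.real (arm B d))⁻¹ * (1 + η⁻¹)) ^ 2 * δ d w.feat ^ 2 := by
    intro d
    rw [← mul_pow]
    refine sq_le_sq.2 ?_
    have h1 : |armIndicator B d w * δ d w.feat| ≤ |δ d w.feat| := by
      rw [abs_mul, abs_of_nonneg (armIndicator_nonneg B d w)]
      exact mul_le_of_le_one_left (abs_nonneg _) (armIndicator_le_one B d w)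
    have h2 := mul_le_mul h1 (abs_one_sub_annotationIndicator_div_le hη hπ_ge w) (abs_nonneg _)
      (abs_nonneg _)
    have h3 : |1 + η⁻¹| = 1 + η⁻¹ := abs_of_nonneg (by positivity)
    rw [← abs_mul, mul_comm] at h2
    rw [abs_mul, abs_mul _ (δ d w.feat), abs_mul _ (1 + η⁻¹), h3,
      mul_assoc |(P.real (arm B d))⁻¹|]
    refine mul_le_mul_of_nonneg_left ?_ (abs_nonneg _)
    rw [mul_comm (1 + η⁻¹), mul_comm (armIndicator B d w * δ d w.feat)]
    exact h2
  have h1 := h true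
  have h2 := h false
  unfold imputationError errorConstant
  set x := (P.real (arm B true))⁻¹ * (armIndicator B true w * δ true w.feat
      * (1 - annotationIndicator w / π w.covariates))
  set y := (P.real (arm B false))⁻¹ * (armIndicator B false w * δ false w.feat
      * (1 - annotationIndicator w / π w.covariates))
  nlinarith [sq_nonneg (x + y)]

lemma lintegral_normalized_imputationError_le {Ω : Type*} [MeasurableSpace Ω] {μ : Measure Ω}
    [IsProbabilityMeasure μ] {W : ℕ → Ω → Obs k l} (hW : ∀ i, HasLaw (W i) P μ)
    (hind : iIndepFun W μ) (hB : MeasurableSet B) (hπ : Measurable π) (hη : 0 < η)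
    (hπ_ge : ∀ x, η ≤ π x) (hP : P ∈ annotationModel B c π)
    (hp : ∀ d, P.real (arm B d) ≠ 0) {δ : Bool → Feat k l → ℝ} (hδ : ∀ d, Measurable (δ d))
    (I : Finset ℕ) :
    ∫⁻ ω, ENNReal.ofReal (((√(I.card : ℝ))⁻¹ * ∑ i ∈ I, imputationError P B π δ (W i ω)) ^ 2) ∂μ
      ≤ ENNReal.ofReal (errorConstant P B η true)
          * ∫⁻ x, ENNReal.ofReal (δ true x ^ 2) ∂(P.map Obs.feat)
        + ENNReal.ofReal (errorConstant P B η false)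
          * ∫⁻ x, ENNReal.ofReal (δ false x ^ 2) ∂(P.map Obs.feat) := by
  have hP1 := hP.1
  have hK : ∀ d, 0 < errorConstant P B η d := fun d => by
    have := hp d
    have h2 : 0 < 1 + η⁻¹ := by positivity
    unfold errorConstant
    positivity
  have hmap : ∀ d, ∫⁻ x, ENNReal.ofReal (δ d x ^ 2) ∂(P.map Obs.feat)
      = ∫⁻ w, ENNReal.ofReal (δ d w.feat ^ 2) ∂P := fun d =>
    lintegral_map (((hδ d).pow_const 2).ennreal_ofReal) Obs.measurable_feat
  by_cases hfin : ∀ d, ∫⁻ x, ENNReal.ofReal (δ d x ^ 2) ∂(P.map Obs.feat) < ∞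
  · have hδL : ∀ d, MemLp (fun w : Obs k l => δ d w.feat) 2 P := fun d => by
      have hm : Measurable fun w : Obs k l => δ d w.feat := (hδ d).comp Obs.measurable_feat
      rw [memLp_two_iff_integrable_sq hm.aestronglyMeasurable]
      refine ⟨(hm.pow_const 2).aestronglyMeasurable, ?_⟩
      rw [hasFiniteIntegral_iff_ofReal (ae_of_all _ fun w => sq_nonneg _), ← hmap]
      exact hfin d
    have hAL : ∀ d, MemLp (fun w : Obs k l => armIndicator B d w * δ d w.feat) 2 P := fun d =>
      (hδL d).of_le_mul (c := 1) ((measurable_armIndicator hB d).aestronglyMeasurable.mul (hδL d).1)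
        (ae_of_all _ fun w => by
          rw [norm_mul, Real.norm_of_nonneg (armIndicator_nonneg B d w)]
          gcongr
          exact armIndicator_le_one B d w)
    have hL := fun d => (memLp_mul_one_sub hπ hη hπ_ge (hAL d)).const_mul (P.real (arm B d))⁻¹
    have hρL : MemLp (imputationError P B π δ) 2 P := (hL true).sub (hL false)
    have hρ0 : ∫ w, imputationError P B π δ w ∂P = 0 := by
      unfold imputationError
      rw [integral_sub ((hL true).integrable one_le_two) ((hL false).integrable one_le_two),
        integral_const_mul, integral_const_mul,
        integral_arm_mul_one_sub hB hπ hη hπ_ge hP (hδ true) ((hAL true).integrable one_le_two),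
        integral_arm_mul_one_sub hB hπ hη hπ_ge hP (hδ false) ((hAL false).integrable one_le_two)]
      simp
    have hρ : Measurable (imputationError P B π δ) := by
      have h1 := measurable_armIndicator (k := k) (l := l) hB
      unfold imputationError
      fun_prop
    refine (lintegral_normalized_sum_sq_le hW hind hρ hρL hρ0 I).trans ?_
    rw [hmap, hmap, ← lintegral_const_mul _ (by fun_prop), ← lintegral_const_mul _ (by fun_prop),
      ← lintegral_add_left (by fun_prop)]
    refine lintegral_mono fun w => ?_
    rw [← ENNReal.ofReal_mul (hK true).le, ← ENNReal.ofReal_mul (hK false).le,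
      ← ENNReal.ofReal_add (mul_nonneg (hK true).le (sq_nonneg _))
        (mul_nonneg (hK false).le (sq_nonneg _))]
    exact ENNReal.ofReal_le_ofReal (imputationError_sq_le hη hπ_ge δ w)
  · simp only [not_forall, not_lt, top_le_iff] at hfin
    obtain ⟨d, hd⟩ := hfin
    have hne : ∀ d, ENNReal.ofReal (errorConstant P B η d) ≠ 0 := fun d => by
      simpa using hK d
    refine le_of_le_of_eq le_top (Eq.symm ?_)
    cases d
    · rw [hd, ENNReal.mul_top (hne false), add_top]
    · rw [hd, ENNReal.mul_top (hne true), top_add]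

/-- Asymptotic normality of the cross-fitted estimator. -/
lemma tendstoInDistribution_estimator {Ω : Type*} [MeasurableSpace Ω] {μ : Measure Ω}
    [IsProbabilityMeasure μ] {W : ℕ → Ω → Obs k l} (hW : ∀ i, HasLaw (W i) P μ)
    (hind : iIndepFun W μ) (hB : MeasurableSet B) (hπ : Measurable π) (hη : 0 < η)
    (hπ_ge : ∀ x, η ≤ π x) (hP : P ∈ annotationModel B c π)
    (hp : ∀ d, P.real (arm B d) ≠ 0) (hreg : ∀ d, IsRegressionFunction P B d (reg d))
    {I J : ℕ → Finset ℕ} (h_disj : ∀ n, Disjoint (I n) (J n))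
    (hI : Tendsto (fun n => (I n).card) atTop atTop)
    {reghat : ∀ n : ℕ, Bool → (J n → Obs k l) → Feat k l → ℝ}
    (h_reghat : ∀ n d, Measurable (Function.uncurry (reghat n d)))
    (h_mse : ∀ d, Tendsto (fun n => ∫⁻ ω, ∫⁻ x,
        ENNReal.ofReal ((reghat n d (fun i => W i ω) x - reg d x) ^ 2) ∂(P.map Obs.feat) ∂μ)
      atTop (𝓝 0)) :
    TendstoInDistribution
      (fun n ω => √((I n).card : ℝ) *
        (armEstimator P B π true (reghat n true (fun i => W i ω)) (I n) (fun i => W i ω)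
          - armEstimator P B π false (reghat n false (fun i => W i ω)) (I n) (fun i => W i ω)
          - (armMean P B true (reg true) - armMean P B false (reg false))))
      atTop (id : ℝ → ℝ) (fun _ => μ)
      (gaussianReal 0 (Var[fun w => armInfluence P B π true (reg true) w
        - armInfluence P B π false (reg false) w; P]).toNNReal) := by
  have hP1 := hP.1
  have hWm : ∀ i, AEMeasurable (W i) μ := fun i => (hW i).aemeasurable
  set φ : Obs k l → ℝ := fun w => armInfluence P B π true (reg true) w
    - armInfluence P B π false (reg false) w with hφ_def
  have hIm := fun d => memLp_armInfluence hB hπ hη hπ_ge hP (hreg d)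
  have hφm : Measurable φ :=
    ((measurable_aipw hB hπ (hreg true).1).sub measurable_const).sub
      ((measurable_aipw hB hπ (hreg false).1).sub measurable_const)
  have hφL : MemLp φ 2 P := (hIm true).sub (hIm false)
  have hφ0 : ∫ w, φ w ∂P = 0 := by
    rw [hφ_def, integral_sub ((hIm true).integrable one_le_two) ((hIm false).integrable one_le_two),
      integral_armInfluence hB hπ hη hπ_ge hP (hreg true),
      integral_armInfluence hB hπ hη hπ_ge hP (hreg false), sub_zero]
  have hclt := tendstoInDistribution_sum_finset hW hind hφm hφL hφ0 hI
  have hT : ∀ n, AEMeasurable (fun ω (j : J n) => W j ω) μ := fun n =>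
    aemeasurable_pi_iff.2 fun j => hWm j
  let δ : ∀ n, (J n → Obs k l) → Bool → Feat k l → ℝ := fun n τ d x => reghat n d τ x - reg d x
  have hδ : ∀ n d, Measurable fun x : (J n → Obs k l) × Feat k l => δ n x.1 d x.2 := fun n d =>
    (h_reghat n d).sub ((hreg d).1.comp measurable_snd)
  let r : ∀ n, (J n → Obs k l) → Obs k l → ℝ := fun n τ w => imputationError P B π (δ n τ) w
  have hr : ∀ n, Measurable (Function.uncurry (r n)) := by
    intro n
    have h1 : ∀ d, Measurable fun x : (J n → Obs k l) × Obs k l => δ n x.1 d x.2.feat := fun d =>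
      (hδ n d).comp (measurable_fst.prodMk (Obs.measurable_feat.comp measurable_snd))
    have h2 : ∀ d, Measurable fun x : (J n → Obs k l) × Obs k l => armIndicator B d x.2 := fun d =>
      (measurable_armIndicator hB d).comp measurable_snd
    have h3 : Measurable fun x : (J n → Obs k l) × Obs k l =>
        1 - annotationIndicator x.2 / π x.2.covariates :=
      (measurable_one_sub_annotationIndicator_div hπ).comp measurable_snd
    exact ((((h2 true).mul (h1 true)).mul h3).const_mul _).sub
      ((((h2 false).mul (h1 false)).mul h3).const_mul _)
  -- the estimation error is the normalized sum of the influence function plus a remainder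
  set R : ℕ → Ω → ℝ := fun n ω =>
    (√((I n).card : ℝ))⁻¹ * ∑ i ∈ I n, r n (fun j => W j ω) (W i ω) with hR
  have hdecomp : ∀ n ω, √((I n).card : ℝ) *
      (armEstimator P B π true (reghat n true (fun i => W i ω)) (I n) (fun i => W i ω)
        - armEstimator P B π false (reghat n false (fun i => W i ω)) (I n) (fun i => W i ω)
        - (armMean P B true (reg true) - armMean P B false (reg false)))
      = (√((I n).card : ℝ))⁻¹ * ∑ i ∈ I n, φ (W i ω) + R n ω := by
    intro n ω
    rcases Finset.eq_empty_or_nonempty (I n) with h0 | h0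
    · simp [h0, hR]
    have hm : (0 : ℝ) < (I n).card := Nat.cast_pos.2 h0.card_pos
    have hsq := Real.sq_sqrt hm.le
    have hs := Real.sqrt_pos.2 hm
    have hsum : ∑ i ∈ I n, aipw P B π true (reghat n true (fun i => W i ω)) (W i ω)
        - ∑ i ∈ I n, aipw P B π false (reghat n false (fun i => W i ω)) (W i ω)
        = ∑ i ∈ I n, φ (W i ω) + ∑ i ∈ I n, r n (fun j => W j ω) (W i ω)
          + (I n).card * (armMean P B true (reg true) - armMean P B false (reg false)) := by
      rw [← Finset.sum_sub_distrib, ← Finset.sum_add_distrib, ← nsmul_eq_mul,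
        ← Finset.sum_const, ← Finset.sum_add_distrib]
      refine Finset.sum_congr rfl fun i _ => ?_
      rw [aipw_sub_aipw_eq_add (fun d => reghat n d (fun i => W i ω)) reg]
      simp only [hφ_def, armInfluence, r, δ]
      ring
    unfold armEstimator
    rw [← mul_sub, hsum]
    simp only [hR]
    set s := √((I n).card : ℝ)
    rw [← hsq]
    field_simp
    ring
  have hRm : ∀ n, AEMeasurable (R n) μ := fun n =>
    (Finset.aemeasurable_fun_sum _ fun i _ =>
      (hr n).comp_aemeasurable ((hT n).prodMk (hWm i))).const_mul _
  have hR0 : Tendsto (fun n => ∫⁻ ω, ENNReal.ofReal (R n ω ^ 2) ∂μ) atTop (𝓝 0) := by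
    have hbm : ∀ n d, Measurable fun τ : J n → Obs k l =>
        ∫⁻ x, ENNReal.ofReal (δ n τ d x ^ 2) ∂(P.map Obs.feat) := fun n d =>
      Measurable.lintegral_prod_right' (ν := P.map Obs.feat)
        (f := fun x : (J n → Obs k l) × Feat k l => ENNReal.ofReal (δ n x.1 d x.2 ^ 2))
        ((hδ n d).pow_const 2).ennreal_ofReal
    have hle : ∀ n, ∫⁻ ω, ENNReal.ofReal (R n ω ^ 2) ∂μ
        ≤ ENNReal.ofReal (errorConstant P B η true) * ∫⁻ ω, ∫⁻ x,
            ENNReal.ofReal (δ n (fun j => W j ω) true x ^ 2) ∂(P.map Obs.feat) ∂μ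
          + ENNReal.ofReal (errorConstant P B η false) * ∫⁻ ω, ∫⁻ x,
            ENNReal.ofReal (δ n (fun j => W j ω) false x ^ 2) ∂(P.map Obs.feat) ∂μ := by
      intro n
      have hcm : ∀ d, AEMeasurable (fun ω => ∫⁻ x,
          ENNReal.ofReal (δ n (fun j => W j ω) d x ^ 2) ∂(P.map Obs.feat)) μ := fun d =>
        (hbm n d).comp_aemeasurable (hT n)
      rw [← lintegral_const_mul'' _ (hcm true), ← lintegral_const_mul'' _ (hcm false),
        ← lintegral_add_left' ((hcm true).const_mul _)]
      exact lintegral_crossfit_le hWm hind (h_disj n) (hr n) _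
        (((hbm n true).const_mul _).add ((hbm n false).const_mul _))
        (fun τ => lintegral_normalized_imputationError_le hW hind hB hπ hη hπ_ge hP hp
          (fun d => (hδ n d).comp measurable_prodMk_left) (I n))
    have hlim := (ENNReal.Tendsto.const_mul (h_mse true)
        (a := ENNReal.ofReal (errorConstant P B η true)) (Or.inr ENNReal.ofReal_ne_top)).add
      (ENNReal.Tendsto.const_mul (h_mse false)
        (a := ENNReal.ofReal (errorConstant P B η false)) (Or.inr ENNReal.ofReal_ne_top))
    simp only [mul_zero, add_zero] at hlim
    exact tendsto_of_tendsto_of_tendsto_of_le_of_le tendsto_const_nhds hlim (fun _ => zero_le) hle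
  have hRmeas : TendstoInMeasure μ R atTop 0 := by
    refine tendstoInMeasure_of_tendsto_eLpNorm two_ne_zero
      (fun n => (hRm n).aestronglyMeasurable) aestronglyMeasurable_zero ?_
    have h := (ENNReal.continuous_rpow_const (y := (1 / 2 : ℝ))).tendsto 0 |>.comp hR0
    rw [ENNReal.zero_rpow_of_pos (by norm_num)] at h
    refine h.congr fun n => ?_
    rw [eLpNorm_eq_lintegral_rpow_enorm_toReal two_ne_zero ENNReal.ofNat_ne_top,
      ENNReal.toReal_ofNat, Function.comp_apply]
    congr 1
    refine lintegral_congr fun ω => ?_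
    rw [sub_zero, ← ofReal_norm, ENNReal.ofReal_rpow_of_nonneg (norm_nonneg _) (by norm_num)]
    simp
  simp only [hdecomp]
  refine tendstoInDistribution_of_tendstoInMeasure_sub _ _ hclt ?_
    (fun n => (hclt.forall_aemeasurable n).add (hRm n))
  convert hRmeas using 1
  ext n ω
  simp

end Estimator

section ConditionalIndependence

variable {S α β : Type*} [mS : MeasurableSpace S] [mα : MeasurableSpace α]
  [mβ : MeasurableSpace β] {μ : Measure S} [IsProbabilityMeasure μ]

/-- If `f` and the event `A` are conditionally independent given `X`, then `P(A ∣ X, f)` and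
`P(A ∣ X)` coincide. -/
lemma condProb_prodMk_of_condIndepFun [StandardBorelSpace S] {X : S → α} {f : S → β} {a : S → Bool} (hX : Measurable X)
    (hf : Measurable f) (ha : Measurable a)
    (h : CondIndepFun (MeasurableSpace.comap X inferInstance) hX.comap_le f a μ)
    {ρ : α → ℝ} (hρ : Measurable ρ) (hρ0 : ∀ x, 0 ≤ ρ x) (hρ1 : ∀ x, ρ x ≤ 1)
    (hscore : μ⟦{s | a s = true} | MeasurableSpace.comap X inferInstance⟧
      =ᵐ[μ] fun s => ρ (X s)) :
    μ⟦{s | a s = true} | MeasurableSpace.comap (fun s => (X s, f s)) inferInstance⟧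
      =ᵐ[μ] fun s => ρ (X s) := by
  have hA : MeasurableSet {s | a s = true} := ha (measurableSet_singleton true)
  set A : Set S := {s | a s = true} with hA_def
  have hZ : Measurable fun s => (X s, f s) := hX.prodMk hf
  have hρi : Integrable (fun s => ρ (X s)) μ :=
    Integrable.of_bound (hρ.comp hX).aestronglyMeasurable 1 (ae_of_all _ fun s => by
      rw [Real.norm_of_nonneg (hρ0 _)]; exact hρ1 _)
  have hAi : Integrable (A.indicator fun _ => (1 : ℝ)) μ := (integrable_const 1).indicator hA
  have hmeas : (μ.restrict A).map (fun s => (X s, f s))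
      = (μ.withDensity fun s => ENNReal.ofReal (ρ (X s))).map (fun s => (X s, f s)) := by
    refine Measure.ext_prod fun {s} {t} hs ht => ?_
    have hs' := hX hs
    have ht' := hf ht
    rw [Measure.map_apply hZ (hs.prod ht), Measure.map_apply hZ (hs.prod ht), Set.mk_preimage_prod,
      Measure.restrict_apply (hs'.inter ht'), withDensity_apply _ (hs'.inter ht'),
      ← ofReal_integral_eq_lintegral_ofReal hρi.restrict (ae_of_all _ fun _ => hρ0 _),
      ← ofReal_measureReal (measure_ne_top _ _)]
    congr 1
    have hci := (condIndepFun_iff_condExp_inter_preimage_eq_mul hf ha).1 h t {true} ht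
      (measurableSet_singleton true)
    have hpre : a ⁻¹' {true} = A := rfl
    rw [hpre] at hci
    have h1 : ∫ x in X ⁻¹' s, (f ⁻¹' t ∩ A).indicator (fun _ => (1 : ℝ)) x ∂μ
        = μ.real (X ⁻¹' s ∩ f ⁻¹' t ∩ A) := by
      rw [integral_indicator (ht'.inter hA), Measure.restrict_restrict (ht'.inter hA)]
      simp only [integral_const, MeasurableSet.univ, measureReal_restrict_apply, Set.univ_inter,
        smul_eq_mul, mul_one]
      congr 1
      ext x
      simp only [Set.mem_inter_iff]
      tauto
    have h2 : ∫ x in X ⁻¹' s, (f ⁻¹' t).indicator (fun _ => (1 : ℝ)) x * ρ (X x) ∂μ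
        = ∫ x in X ⁻¹' s ∩ f ⁻¹' t, ρ (X x) ∂μ := by
      rw [← integral_indicator hs', ← integral_indicator (hs'.inter ht')]
      refine integral_congr_ae (ae_of_all _ fun x => ?_)
      by_cases hxs : x ∈ X ⁻¹' s <;> by_cases hxt : x ∈ f ⁻¹' t <;>
        simp [hxs, hxt]
    have hti : Integrable ((f ⁻¹' t).indicator fun _ => (1 : ℝ)) μ :=
      (integrable_const 1).indicator ht'
    have hρX : StronglyMeasurable[MeasurableSpace.comap X inferInstance] fun x => ρ (X x) :=
      (hρ.comp (comap_measurable X)).stronglyMeasurable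
    have hprod : Integrable (((f ⁻¹' t).indicator fun _ => (1 : ℝ)) * fun x => ρ (X x)) μ := by
      refine hρi.bdd_mul (c := 1) hti.1 (ae_of_all _ fun x => ?_)
      exact (norm_indicator_le_norm_self _ _).trans (by simp)
    have h3 := condExp_mul_of_stronglyMeasurable_right hρX hprod hti
    have h4 := setIntegral_condExp hX.comap_le hprod ⟨s, hs, rfl⟩
    have h5 := setIntegral_condExp hX.comap_le
      (((integrable_const (1 : ℝ)).indicator (ht'.inter hA)) :
        Integrable ((f ⁻¹' t ∩ A).indicator fun _ => (1 : ℝ)) μ) ⟨s, hs, rfl⟩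
    rw [← h1, ← h2, ← h5]
    refine Eq.trans ?_ h4
    refine setIntegral_congr_ae hs' ?_
    filter_upwards [h3, hci, hscore] with x e1 e2 e3 _
    rw [e1, e2, e3]
    rfl
  symm
  refine ae_eq_condExp_of_forall_setIntegral_eq hZ.comap_le hAi (fun _ _ _ => hρi.integrableOn)
    ?_ ?_
  · rintro _ ⟨C, hC, rfl⟩ -
    have hC' := hZ hC
    have h1 := congrArg (fun ν => ν C) hmeas
    rw [Measure.map_apply hZ hC, Measure.map_apply hZ hC, Measure.restrict_apply hC',
      withDensity_apply _ hC', ← ofReal_integral_eq_lintegral_ofReal hρi.restrict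
        (ae_of_all _ fun _ => hρ0 _)] at h1
    have h2 := congrArg ENNReal.toReal h1
    rw [ENNReal.toReal_ofReal (integral_nonneg fun _ => hρ0 _)] at h2
    rw [← h2, integral_indicator hA, Measure.restrict_restrict hA]
    simp [Measure.real, Set.inter_comm]
  · exact ((hρ.comp measurable_fst).comp (comap_measurable _)).stronglyMeasurable.aestronglyMeasurable

/-- Integrating against the indicator of an event amounts to integrating against its conditional
probability. -/
lemma integral_mul_indicator_of_condProb {Z : S → α} (hZ : Measurable Z) {A : Set S}
    (hA : MeasurableSet A) {ρ : S → ℝ}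
    (hscore : μ⟦A | MeasurableSpace.comap Z inferInstance⟧ =ᵐ[μ] ρ)
    {F : α → ℝ} (hF : Measurable F) (hFi : Integrable (fun s => F (Z s)) μ) :
    ∫ s, F (Z s) * A.indicator (fun _ => 1) s ∂μ = ∫ s, F (Z s) * ρ s ∂μ := by
  have hAi : Integrable (A.indicator fun _ => (1 : ℝ)) μ := (integrable_const 1).indicator hA
  have hFm : StronglyMeasurable[MeasurableSpace.comap Z inferInstance] fun s => F (Z s) :=
    (hF.comp (comap_measurable Z)).stronglyMeasurable
  have hprod : Integrable ((fun s => F (Z s)) * A.indicator fun _ => (1 : ℝ)) μ := by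
    refine hFi.mul_bdd (c := 1) hAi.1 (ae_of_all _ fun x => ?_)
    exact (norm_indicator_le_norm_self _ _).trans (by simp)
  have h1 := condExp_mul_of_stronglyMeasurable_left hFm hprod hAi
  have h2 := integral_condExp (μ := μ) hZ.comap_le
    (f := (fun s => F (Z s)) * A.indicator fun _ => (1 : ℝ))
  refine Eq.trans h2.symm (integral_congr_ae ?_)
  filter_upwards [h1, hscore] with s e1 e2
  rw [e1, Pi.mul_apply, e2]

end ConditionalIndependence

namespace PopulationUnit

variable {k l : ℕ} {S : Type*} [MeasurableSpace S] (u : PopulationUnit k l S)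

lemma measurable_obs : Measurable u.obs := by
  have h : Measurable u.outcome :=
    (Measurable.ite (u.measurable_annotation (measurableSet_singleton true)) measurable_const
      measurable_const).mul u.measurable_truth
  exact h.prodMk (u.measurable_running.prodMk (u.measurable_treatment.prodMk
    (u.measurable_annotation.prodMk (u.measurable_covariates.prodMk u.measurable_unstructured))))

/-- The event `{A = 1}` in the population. -/
def annotatedEvent : Set S := {s | u.annotation s = true}

lemma measurableSet_annotatedEvent : MeasurableSet u.annotatedEvent :=
  u.measurable_annotation (measurableSet_singleton true)

/-- All variables except the annotation indicator: `((X, U, M*), (R, D))`. -/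
def designFeat (s : S) : ((Fin k → ℝ) × (Fin l → ℝ) × ℝ) × ℝ × Bool :=
  (u.covUnstrTruth s, u.running s, u.treatment s)

lemma measurable_designFeat : Measurable u.designFeat :=
  u.measurable_covUnstrTruth.prodMk (u.measurable_running.prodMk u.measurable_treatment)

/-- The event `{R ∈ B, D = d}` in the population. -/
def armEvent (B : Set ℝ) (d : Bool) : Set S := {s | u.running s ∈ B ∧ u.treatment s = d}

lemma measurableSet_armEvent {B : Set ℝ} (hB : MeasurableSet B) (d : Bool) :
    MeasurableSet (u.armEvent B d) :=
  (u.measurable_running hB).inter (u.measurable_treatment (measurableSet_singleton d))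

lemma preimage_arm (B : Set ℝ) (d : Bool) : u.obs ⁻¹' arm B d = u.armEvent B d := rfl

lemma law_arm (μ : Measure S) {B : Set ℝ} (hB : MeasurableSet B) (d : Bool) :
    (u.law μ).real (arm B d) = μ.real (u.armEvent B d) := by
  rw [law, map_measureReal_apply u.measurable_obs (measurableSet_arm hB d), preimage_arm]

/-- The extended features as a function of the design variables. -/
noncomputable def designToExtended (B : Set ℝ)
    (z : ((Fin k → ℝ) × (Fin l → ℝ) × ℝ) × ℝ × Bool) : Feat k l × ℝ × ℝ :=
  ((z.1.1, z.1.2.1),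
    {z : ((Fin k → ℝ) × (Fin l → ℝ) × ℝ) × ℝ × Bool | z.2.1 ∈ B ∧ z.2.2 = true}.indicator
      (fun _ => 1) z,
    {z : ((Fin k → ℝ) × (Fin l → ℝ) × ℝ) × ℝ × Bool | z.2.1 ∈ B ∧ z.2.2 = false}.indicator
      (fun _ => 1) z)

lemma measurable_designToExtended {B : Set ℝ} (hB : MeasurableSet B) :
    Measurable (designToExtended (k := k) (l := l) B) := by
  have h : ∀ d : Bool, MeasurableSet
      {z : ((Fin k → ℝ) × (Fin l → ℝ) × ℝ) × ℝ × Bool | z.2.1 ∈ B ∧ z.2.2 = d} := fun d =>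
    (hB.preimage (measurable_fst.comp measurable_snd)).inter
      ((measurableSet_singleton d).preimage (measurable_snd.comp measurable_snd))
  have h1 : Measurable fun z : ((Fin k → ℝ) × (Fin l → ℝ) × ℝ) × ℝ × Bool =>
      (z.1.1, z.1.2.1) := by fun_prop
  exact h1.prodMk ((measurable_const.indicator (h true)).prodMk (measurable_const.indicator (h false)))

variable {μ : Measure S} [IsProbabilityMeasure μ] {c : ℝ} {B : Set ℝ} {π : (Fin k → ℝ) → ℝ}
  {η : ℝ}

lemma annotationIndicator_obs (s : S) : annotationIndicator (u.obs s)
    = u.annotatedEvent.indicator (fun _ => 1) s := by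
  by_cases h : s ∈ u.annotatedEvent
  · rw [Set.indicator_of_mem h]
    exact if_pos h
  · rw [Set.indicator_of_notMem h]
    exact if_neg h

lemma law_mem_annotationModel (hB : MeasurableSet B)
    (h_sharp : ∀ᵐ s ∂μ, u.treatment s = true ↔ c ≤ u.running s)
    (h_sq : MemLp u.truth 2 μ) (hπ : Measurable π) (hπ0 : ∀ x, 0 ≤ π x) (hπ1 : ∀ x, π x ≤ 1)
    (hcond : μ⟦u.annotatedEvent | MeasurableSpace.comap u.designFeat inferInstance⟧
      =ᵐ[μ] fun s => π (u.covariates s)) :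
    u.law μ ∈ annotationModel B c π := by
  have ho := u.measurable_obs
  have hpr : IsProbabilityMeasure (u.law μ) := Measure.isProbabilityMeasure_map ho.aemeasurable
  refine ⟨hpr, ?_, ?_, ?_, ?_⟩
  · rw [law, memLp_map_measure_iff Obs.measurable_outcome.aestronglyMeasurable ho.aemeasurable]
    refine h_sq.of_le_mul (c := 1) (Obs.measurable_outcome.comp ho).aestronglyMeasurable
      (ae_of_all _ fun s => ?_)
    simp only [Function.comp_apply, obs, Obs.outcome, outcome]
    split_ifs <;> simp
  · refine (ae_map_iff ho.aemeasurable ?_).2 h_sharp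
    have h1 : MeasurableSet {w : Obs k l | w.treatment = true} :=
      Obs.measurable_treatment (measurableSet_singleton true)
    have h2 : MeasurableSet {w : Obs k l | c ≤ w.running} :=
      measurableSet_le measurable_const Obs.measurable_running
    exact measurableSet_setOfPred.2 ((measurableSet_setOfPred.1 h1).iff (measurableSet_setOfPred.1 h2))
  · refine (ae_map_iff ho.aemeasurable ?_).2 (ae_of_all _ fun s => ?_)
    · have h1 : MeasurableSet {w : Obs k l | w.annotation = false} :=
        Obs.measurable_annotation (measurableSet_singleton false)
      have h2 : MeasurableSet {w : Obs k l | w.outcome = 0} :=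
        Obs.measurable_outcome (measurableSet_singleton 0)
      exact measurableSet_setOfPred.2 ((measurableSet_setOfPred.1 h1).imp (measurableSet_setOfPred.1 h2))
    · simp only [obs, Obs.annotation, Obs.outcome, outcome]
      intro h
      simp [h]
  · rw [score_iff hB hπ hπ0 hπ1]
    intro C hC
    have hE := measurable_extendedFeat (k := k) (l := l) hB
    have hC' : MeasurableSet (designToExtended (k := k) (l := l) B ⁻¹' C) :=
      measurable_designToExtended hB hC
    rw [law, setIntegral_map (hE hC) (Measurable.aestronglyMeasurable (by fun_prop)) ho.aemeasurable]
    have hset : u.obs ⁻¹' (extendedFeat B ⁻¹' C)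
        = u.designFeat ⁻¹' (designToExtended B ⁻¹' C) := rfl
    have hA := u.measurableSet_annotatedEvent
    have hAi : Integrable (u.annotatedEvent.indicator fun _ => (1 : ℝ)) μ :=
      (integrable_const 1).indicator hA
    have hπi : Integrable (fun s => π (u.covariates s)) μ := integrable_condExp.congr hcond
    rw [hset]
    simp only [annotationIndicator_obs]
    have hcov : ∀ s, (u.obs s).covariates = u.covariates s := fun _ => rfl
    simp only [hcov]
    rw [integral_sub hAi.restrict hπi.restrict, sub_eq_zero,
      ← setIntegral_condExp u.measurable_designFeat.comap_le hAi ⟨_, hC', rfl⟩]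
    exact setIntegral_congr_ae (u.measurable_designFeat hC') (hcond.mono fun s hs _ => hs)

/-- Inverse propensity weighting recovers the mean of the ground truth over an arm. -/
lemma integral_ipwOutcome_law (hB : MeasurableSet B)
    (h_sq : MemLp u.truth 2 μ) (hπ : Measurable π) (hη : 0 < η) (hπ_ge : ∀ x, η ≤ π x)
    (hcond : μ⟦u.annotatedEvent | MeasurableSpace.comap u.designFeat inferInstance⟧
      =ᵐ[μ] fun s => π (u.covariates s)) (d : Bool) :
    ∫ w, ipwOutcome B π d w ∂(u.law μ) = ∫ s in u.armEvent B d, u.truth s ∂μ := by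
  have ho := u.measurable_obs
  have hπ0 : ∀ x, 0 < π x := fun x => hη.trans_le (hπ_ge x)
  have hA := u.measurableSet_annotatedEvent
  let D : Set (((Fin k → ℝ) × (Fin l → ℝ) × ℝ) × ℝ × Bool) := {z | z.2.1 ∈ B ∧ z.2.2 = d}
  have hD : MeasurableSet D :=
    (hB.preimage (measurable_fst.comp measurable_snd)).inter
      ((measurableSet_singleton d).preimage (measurable_snd.comp measurable_snd))
  let F : ((Fin k → ℝ) × (Fin l → ℝ) × ℝ) × ℝ × Bool → ℝ :=
    D.indicator fun z => (π z.1.1)⁻¹ * z.1.2.2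
  have hF : Measurable F := Measurable.indicator (by fun_prop) hD
  have hFi : Integrable (fun s => F (u.designFeat s)) μ := by
    refine (h_sq.of_le_mul (c := η⁻¹)
      (hF.comp u.measurable_designFeat).aestronglyMeasurable (ae_of_all _ fun s => ?_)).integrable
        one_le_two
    have hle : ‖F (u.designFeat s)‖ ≤ ‖(π (u.covariates s))⁻¹ * u.truth s‖ :=
      norm_indicator_le_norm_self (s := D)
        (fun z : ((Fin k → ℝ) × (Fin l → ℝ) × ℝ) × ℝ × Bool => (π z.1.1)⁻¹ * z.1.2.2) _
    refine hle.trans ?_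
    rw [norm_mul, norm_inv, Real.norm_of_nonneg (hπ0 _).le]
    exact mul_le_mul_of_nonneg_right (inv_anti₀ hη (hπ_ge _)) (norm_nonneg _)
  have h := integral_mul_indicator_of_condProb u.measurable_designFeat hA hcond hF hFi
  rw [law, integral_map ho.aemeasurable (measurable_ipwOutcome hB hπ d).aestronglyMeasurable]
  have e1 : ∀ s, ipwOutcome B π d (u.obs s)
      = F (u.designFeat s) * u.annotatedEvent.indicator (fun _ => 1) s := by
    intro s
    rw [← annotationIndicator_obs]
    have e3 : ∀ s, (u.obs s).outcome = annotationIndicator (u.obs s) * u.truth s := fun _ => rfl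
    by_cases hs : s ∈ u.armEvent B d
    · have h1 : u.designFeat s ∈ D := hs
      have h2 : u.obs s ∈ arm B d := hs
      have h3 := annotationIndicator_mul_self (u.obs s)
      simp only [ipwOutcome, armIndicator, F, Set.indicator_of_mem h1, Set.indicator_of_mem h2, e3]
      change _ = (π (u.covariates s))⁻¹ * u.truth s * _
      change 1 * _ * ((π (u.covariates s))⁻¹ * _) = _
      linear_combination ((π (u.covariates s))⁻¹ * u.truth s) * h3
    · have h1 : u.designFeat s ∉ D := hs
      have h2 : u.obs s ∉ arm B d := hs
      simp [ipwOutcome, armIndicator, F, h1, h2]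
  have e2 : ∀ s, F (u.designFeat s) * π (u.covariates s)
      = (u.armEvent B d).indicator u.truth s := by
    intro s
    by_cases hs : s ∈ u.armEvent B d
    · have h1 : u.designFeat s ∈ D := hs
      simp only [F, Set.indicator_of_mem h1, Set.indicator_of_mem hs]
      change (π (u.covariates s))⁻¹ * u.truth s * _ = _
      field_simp [(hπ0 (u.covariates s)).ne']
    · have h1 : u.designFeat s ∉ D := hs
      simp [F, h1, hs]
  simp only [e1]
  rw [h]
  simp only [e2]
  exact integral_indicator (u.measurableSet_armEvent hB d)

/-- Under local randomization, the mean potential outcome in the window is the mean ground truth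
over the corresponding arm. -/
lemma integral_potential_cond (hB : MeasurableSet B) (d : Bool) (h_arm : μ (u.armEvent B d) ≠ 0)
    (h_lr : IndepFun u.treatment (fun s => (u.potential true s, u.potential false s))
      (μ[|u.running ⁻¹' B]))
    (h_sq : MemLp u.truth 2 μ) :
    Integrable (u.potential d) (μ[|u.running ⁻¹' B]) ∧
      ∫ s, u.potential d s ∂(μ[|u.running ⁻¹' B])
        = (μ.real (u.armEvent B d))⁻¹ * ∫ s in u.armEvent B d, u.truth s ∂μ := by
  have hRB : MeasurableSet (u.running ⁻¹' B) := u.measurable_running hB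
  have hD : MeasurableSet {s | u.treatment s = d} :=
    u.measurable_treatment (measurableSet_singleton d)
  have harm : u.armEvent B d = u.running ⁻¹' B ∩ {s | u.treatment s = d} := rfl
  have hR0 : μ (u.running ⁻¹' B) ≠ 0 := fun h => h_arm (measure_mono_null Set.inter_subset_left h)
  set ν := μ[|u.running ⁻¹' B] with hν
  have hνp : IsProbabilityMeasure ν := cond_isProbabilityMeasure hR0
  let T : S → ℝ := {s | u.treatment s = d}.indicator fun _ => 1
  have hT : Measurable T := measurable_const.indicator hD
  have hTY : IndepFun T (u.potential d) ν := by
    have h1 : Measurable fun b : Bool => if b = d then (1 : ℝ) else 0 := measurable_from_top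
    have h2 : Measurable fun y : ℝ × ℝ => if d then y.1 else y.2 := by
      cases d
      · exact measurable_snd
      · exact measurable_fst
    have h3 := h_lr.comp h1 h2
    convert h3 using 1
    · ext s
      simp [T, Set.indicator_apply]
    · ext s
      cases d <;> simp
  have hmul : ∀ s, T s * u.potential d s = {s | u.treatment s = d}.indicator u.truth s := by
    intro s
    by_cases hs : u.treatment s = d
    · have : s ∈ {s | u.treatment s = d} := hs
      simp only [T, Set.indicator_of_mem this, one_mul, truth]
      cases d <;> simp [hs]
    · simp [T, hs]
  have htr : Integrable u.truth ν :=
    (MemLp.cond (h_sq.restrict _)).integrable one_le_two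
  have hi : Integrable (fun s => T s * u.potential d s) ν := by
    simp only [hmul]
    exact htr.indicator hD
  have hTint : ∫ s, T s ∂ν = (μ.real (u.running ⁻¹' B))⁻¹ * μ.real (u.armEvent B d) := by
    rw [integral_indicator hD]
    simp only [integral_const, MeasurableSet.univ, measureReal_restrict_apply, Set.univ_inter,
      smul_eq_mul, mul_one]
    rw [Measure.real, hν, cond_apply hRB, ENNReal.toReal_mul, ENNReal.toReal_inv, harm]
    rfl
  have hp : μ.real (u.armEvent B d) ≠ 0 := by
    simpa [Measure.real, ENNReal.toReal_eq_zero_iff] using h_arm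
  have hq : μ.real (u.running ⁻¹' B) ≠ 0 := by
    simpa [Measure.real, ENNReal.toReal_eq_zero_iff] using hR0
  have hT0 : ¬ T =ᵐ[ν] 0 := by
    intro h
    have := integral_congr_ae h
    rw [hTint] at this
    simp only [Pi.zero_apply, integral_zero] at this
    exact mul_ne_zero (inv_ne_zero hq) hp this
  refine ⟨hTY.integrable_right_of_integrable_op (fun x y : ℝ => x * y) 1 one_ne_zero
    (fun x y => by simp [enorm_mul]) hi hT.aestronglyMeasurable
    (u.measurable_potential d).aestronglyMeasurable hT0, ?_⟩
  have h1 := hTY.integral_fun_mul_eq_mul_integral hT.aestronglyMeasurable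
    (u.measurable_potential d).aestronglyMeasurable
  have h2 : ∫ s, T s * u.potential d s ∂ν
      = (μ.real (u.running ⁻¹' B))⁻¹ * ∫ s in u.armEvent B d, u.truth s ∂μ := by
    simp only [hmul]
    rw [integral_indicator hD, hν, ProbabilityTheory.cond, Measure.restrict_smul,
      integral_smul_measure, ENNReal.toReal_inv, Measure.restrict_restrict hD, harm, Set.inter_comm]
    rfl
  rw [h2, hTint, mul_assoc] at h1
  have h3 := mul_left_cancel₀ (inv_ne_zero hq) h1
  rw [h3]
  field_simp

lemma condProb_annotated [StandardBorelSpace S]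
    (h_mar : CondIndepFun (MeasurableSpace.comap u.covariates inferInstance)
      u.measurable_covariates.comap_le
      (fun s => (u.unstructured s, u.truth s)) u.annotation μ)
    (h_design : CondIndepFun (MeasurableSpace.comap u.covUnstrTruth inferInstance)
      u.measurable_covUnstrTruth.comap_le
      (fun s => (u.running s, u.treatment s)) u.annotation μ)
    (hπ : Measurable π) (hπ0 : ∀ x, 0 ≤ π x) (hπ1 : ∀ x, π x ≤ 1)
    (hπ_score : μ⟦{s | u.annotation s = true} |
        MeasurableSpace.comap u.covariates inferInstance⟧ =ᵐ[μ] fun s => π (u.covariates s)) :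
    μ⟦{s | u.annotation s = true} | MeasurableSpace.comap u.designFeat inferInstance⟧
      =ᵐ[μ] fun s => π (u.covariates s) := by
  have h1 := condProb_prodMk_of_condIndepFun u.measurable_covariates
    (u.measurable_unstructured.prodMk u.measurable_truth) u.measurable_annotation h_mar hπ hπ0 hπ1
    hπ_score
  exact condProb_prodMk_of_condIndepFun u.measurable_covUnstrTruth
    (u.measurable_running.prodMk u.measurable_treatment) u.measurable_annotation h_design
    (hπ.comp measurable_fst) (fun _ => hπ0 _) (fun _ => hπ1 _) h1

end PopulationUnit

end MARS

theorem mainTheorem8 {k l : ℕ}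
    -- the generic unit of the population
    {S : Type*} [MeasurableSpace S] [StandardBorelSpace S] (μ : Measure S) [IsProbabilityMeasure μ]
    (u : MARS.PopulationUnit k l S)
    -- sharp design with cutoff `c`, and a window `B` with units on both sides
    (c : ℝ) (B : Set ℝ) (hB : MeasurableSet B)
    (h_sharp : ∀ᵐ s ∂μ, u.treatment s = true ↔ c ≤ u.running s)
    (h_arm : ∀ d : Bool, μ {s | u.running s ∈ B ∧ u.treatment s = d} ≠ 0)
    -- local randomization within the window
    (h_lr : IndepFun u.treatment (fun s => (u.potential true s, u.potential false s))
      (μ[|u.running ⁻¹' B]))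
    -- the ground truth outcome has a finite second moment
    (h_sq : MemLp u.truth 2 μ)
    -- missing at random structured data
    (h_mar : CondIndepFun (MeasurableSpace.comap u.covariates inferInstance)
      u.measurable_covariates.comap_le
      (fun s => (u.unstructured s, u.truth s)) u.annotation μ)
    (h_design : CondIndepFun (MeasurableSpace.comap u.covUnstrTruth inferInstance)
      u.measurable_covUnstrTruth.comap_le
      (fun s => (u.running s, u.treatment s)) u.annotation μ)
    -- known annotation score, bounded away from zero
    (π : (Fin k → ℝ) → ℝ) (hπ : Measurable π) (η : ℝ) (hη₀ : 0 < η) (hη₁ : η < 1)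
    (hπ_mem : ∀ x, π x ∈ Set.Icc η 1)
    (hπ_score : μ⟦{s | u.annotation s = true} |
        MeasurableSpace.comap u.covariates inferInstance⟧ =ᵐ[μ] fun s => π (u.covariates s))
    -- the regression functions `μ_1` and `μ_0`
    (reg : Bool → MARS.Feat k l → ℝ)
    (h_reg : ∀ d, MARS.IsRegressionFunction (u.law μ) B d (reg d))
    -- the sample: i.i.d. observations from the law of the generic unit
    {Ω : Type*} [MeasurableSpace Ω] (ℙ' : Measure Ω) [IsProbabilityMeasure ℙ']
    (W : ℕ → Ω → MARS.Obs k l) (hW_law : ∀ i, HasLaw (W i) (u.law μ) ℙ')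
    (hW_indep : iIndepFun W ℙ')
    -- estimation samples `I n` and training samples `I' n`
    (I I' : ℕ → Finset ℕ) (h_disj : ∀ n, Disjoint (I n) (I' n))
    (hI : Tendsto (fun n => (I n).card) atTop atTop)
    (hI' : Tendsto (fun n => (I' n).card) atTop atTop)
    -- imputation functions, which depend on the training samples only
    (reghat : ∀ n : ℕ, Bool → (I' n → MARS.Obs k l) → MARS.Feat k l → ℝ)
    (h_reghat : ∀ n d, Measurable (Function.uncurry (reghat n d)))
    -- mean square consistency of the imputation functions
    (h_mse : ∀ d, Tendsto (fun n => ∫⁻ ω, ∫⁻ x,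
        ENNReal.ofReal ((reghat n d (fun i => W i ω) x - reg d x) ^ 2)
          ∂((u.law μ).map MARS.Obs.feat) ∂ℙ') atTop (𝓝 0)) :
    -- asymptotic normality
    TendstoInDistribution
        (fun n ω => √((I n).card : ℝ) *
          (MARS.armEstimator (u.law μ) B π true
              (reghat n true (fun i => W i ω)) (I n) (fun i => W i ω)
            - MARS.armEstimator (u.law μ) B π false
              (reghat n false (fun i => W i ω)) (I n) (fun i => W i ω)
            - u.estimand μ B))
        atTop (id : ℝ → ℝ) (fun _ => ℙ')
        (gaussianReal 0 (Var[fun w => MARS.armInfluence (u.law μ) B π true (reg true) w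
            - MARS.armInfluence (u.law μ) B π false (reg false) w; u.law μ]).toNNReal)
      -- the functional takes the value `θ` at the true law
      ∧ MARS.functional B (fun d => (u.law μ).real (MARS.arm B d)) (u.law μ) = u.estimand μ B
      -- the efficient influence function
      ∧ MARS.IsEfficientInfluenceFunction (MARS.annotationModel B c π) MARS.Obs.outcome
          (MARS.functional B (fun d => (u.law μ).real (MARS.arm B d))) (u.law μ)
          (fun w => MARS.armInfluence (u.law μ) B π true (reg true) w
            - MARS.armInfluence (u.law μ) B π false (reg false) w) := by
  have hπ_ge := fun x => (hπ_mem x).1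
  have hπ1 : ∀ x, π x ≤ 1 := fun x => (hπ_mem x).2
  have hπ0 : ∀ x, (π x ≥ 0) := fun x => hη₀.le.trans (hπ_ge x)
  have hcond := u.condProb_annotated h_mar h_design hπ hπ0 hπ1 hπ_score
  have hP := u.law_mem_annotationModel hB h_sharp h_sq hπ hπ0 hπ1 hcond
  have hp : ∀ d, (u.law μ).real (MARS.arm B d) ≠ 0 := fun d => by
    rw [u.law_arm μ hB d]
    exact ENNReal.toReal_ne_zero.2 ⟨h_arm d, measure_ne_top _ _⟩
  have hψ := MARS.functional_eq_armMean_sub hB hπ hη₀ hπ_ge hP h_reg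
  have hθ : MARS.functional B (fun d => (u.law μ).real (MARS.arm B d)) (u.law μ)
      = u.estimand μ B := by
    have hY := fun d => u.integral_potential_cond hB d (h_arm d) h_lr h_sq
    rw [MARS.functional_eq hB hπ hη₀ hπ_ge _ hP, MARS.PopulationUnit.estimand,
      integral_sub (hY true).1 (hY false).1, (hY true).2, (hY false).2,
      u.integral_ipwOutcome_law hB h_sq hπ hη₀ hπ_ge hcond,
      u.integral_ipwOutcome_law hB h_sq hπ hη₀ hπ_ge hcond, u.law_arm μ hB, u.law_arm μ hB]
  have hL := fun d => MARS.memLp_armInfluence hB hπ hη₀ hπ_ge hP (h_reg d)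
  have hI0 := fun d => MARS.integral_armInfluence hB hπ hη₀ hπ_ge hP (h_reg d)
  have hPp := hP.1
  refine ⟨?_, hθ, ?_⟩
  · rw [← hθ, hψ]
    exact MARS.tendstoInDistribution_estimator hW_law hW_indep hB hπ hη₀ hπ_ge hP hp h_reg h_disj
      hI h_reghat h_mse
  · exact
      { mem_model := hP
        memLp := (hL true).sub (hL false)
        mean_zero := by
          rw [integral_sub ((hL true).integrable one_le_two) ((hL false).integrable one_le_two),
            hI0, hI0, sub_zero]
        pathwise_derivative := fun Q h hQ =>
          MARS.tendsto_functional_difference_quotient hB hπ hη₀ hπ_ge hP h_reg hQ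
        mem_tangentSpace :=
          MARS.toLp_influence_mem_tangentSpace hB hπ hη₀ hπ_ge hπ1 hP h_reg _ }
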